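/- Let $\mathbb X=(X_k)_{k\in\mathbb N}$ be a sequence of independent random variables on a probability space $(\Omega,\mathcal A,\mathbb P)$, where $X_k$ takes values in an arbitrary measurable space $(E_k,\mathcal B_k)$. For $M\subseteq\mathbb N$ let $\mathcal F_M=\sigma(X_j,\,j\in M)$, and put $\mathcal F=\mathcal F_{\mathbb N}$ and $\mathcal G_k=\mathcal F_{\mathbb N\setminus\{k\}}$. Let $L^2_{\mathbb X}=L^2(\Omega,\mathcal F,\mathbb P)$ be the real Hilbert space of square-integrable $\sigma(\mathbb X)$-measurable random variables. For an integrable real random variable $F$ put $D_kF=F-\mathbb E[F\mid\mathcal G_k]$. On the space $\mathcal S$ of all $F\in L^2_{\mathbb X}$ that are $\sigma(X_1,\dots,X_n)$-measurable for some $n$, the map $F\mapsto(D_kF)_{k\in\mathbb N}$ takes values in the Hilbert space $\mathcal U$ of all sequences $U=(U_k)_{k\in\mathbb N}$ in $L^2_{\mathbb X}$ with $\sum_k\mathbb E[U_k^2]<\infty$. The Malliavin derivative $D:\operatorname{dom}(D)\subseteq L^2_{\mathbb X}\to\mathcal U$ is the closure of this operator, $\delta$ is its Hilbert space adjoint, and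 $L=-\delta D$, with domain $\operatorname{dom}(L)=\{F\in\operatorname{dom}(D): DF\in\operatorname{dom}(\delta)\}$. For centered $F\in L^2_{\mathbb X}$, $L^{-1}F$ denotes the unique centered $G\in\operatorname{dom}(L)$ with $LG=F$. For real random variables $Y,W$ let $d_{\mathcal W}(Y,W)=\sup_h|\mathbb E[h(Y)]-\mathbb E[h(W)]|$, where the supremum is over all $h:\mathbb R\to\mathbb R$ that are Lipschitz with constant $1$ (here $Y,W$ are integrable), and $d_{\mathcal K}(Y,W)=\sup_{z\in\mathbb R}|\mathbb P(Y\le z)-\mathbb P(W\le z)|$. Let $Z\sim N(0,1)$. **Theorem (Malliavin–Stein bounds).** Let $F\in\operatorname{dom}(D)$ with $\mathbb E[F]=0$. Then $L^{-1}F$ exists, the series $\sum_k D_k(-L^{-1}F)\,D_kF$ and $\sum_k\mathbb E[|D_kL^{-1}F|\mid\mathcal G_k]\,D_kF$ converge absolutely $\mathbb P$-almost surely, and (in $[0,\infty]$) $$d_{\mathcal W}(F,Z)\le\sqrt{\frac2\pi}\;\mathbb E\Bigl|1-\sum_{k=1}^\infty D_k(-L^{-1}F)\,D_kF\Bigr|+\sum_{k=1}^\infty\mathbb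 E\Bigl[\bigl|D_k(-L^{-1}F)\bigr|\,(D_kF)^2\Bigr]$$ and $$d_{\mathcal K}(F,Z)\le\mathbb E\Bigl|1-\sum_{k=1}^\infty D_k(-L^{-1}F)\,D_kF\Bigr|+2\sum_{k=1}^\infty\mathbb E\Bigl|D_k\bigl|D_kL^{-1}F\bigr|\;D_kF\Bigr|+2\,\mathbb E\Bigl|\sum_{k=1}^\infty\mathbb E\bigl[|D_kL^{-1}F|\,\big|\,\mathcal G_k\bigr]\,D_kF\Bigr|.$$ -/

import Mathlib

open MeasureTheory ProbabilityTheory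
open scoped ENNReal

namespace ProdMalliavin

section Distances

/-- Wasserstein distance between two laws on `ℝ`:
the supremum of `|∫ h dμ - ∫ h dν|` over all 1-Lipschitz functions `h`. -/
noncomputable def dWass (μ ν : Measure ℝ) : ℝ≥0∞ :=
  ⨆ (h : ℝ → ℝ) (_ : LipschitzWith 1 h), ENNReal.ofReal |∫ x, h x ∂μ - ∫ x, h x ∂ν|

/-- Kolmogorov distance between two laws on `ℝ`: the supremum distance of the
distribution functions. -/
noncomputable def dKol (μ ν : Measure ℝ) : ℝ≥0∞ :=
  ⨆ z : ℝ, ENNReal.ofReal |μ.real (Set.Iic z) - ν.real (Set.Iic z)|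

end Distances

section Setup

variable {Ω : Type*} [mΩ : MeasurableSpace Ω] {E : ℕ → Type*} [∀ n, MeasurableSpace (E n)]

/-- The sigma-algebra `σ(X_j, j ∈ M)` on `Ω`. -/
@[reducible] def sigmaOf (X : ∀ n, Ω → E n) (M : Set ℕ) : MeasurableSpace Ω :=
  ⨆ j ∈ M, MeasurableSpace.comap (X j) inferInstance

theorem sigmaOf_mono {Ω : Type*} {E : ℕ → Type*} [∀ n, MeasurableSpace (E n)] (X : ∀ n, Ω → E n) {M N : Set ℕ} (h : M ⊆ N) :
    sigmaOf X M ≤ sigmaOf X N :=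
  biSup_mono h

theorem sigmaOf_le {X : ∀ n, Ω → E n} (hX : ∀ n, Measurable (X n)) (M : Set ℕ) :
    sigmaOf X M ≤ mΩ :=
  iSup₂_le fun j _ => (hX j).comap_le

/-- The difference operator `D_k F = F - 𝔼[F | 𝒢_k]`, where `𝒢_k = σ(X_j, j ≠ k)`,
acting on (integrable) random variables. -/
noncomputable def diffOp (X : ∀ n, Ω → E n) (P : Measure Ω) (k : ℕ) (F : Ω → ℝ) : Ω → ℝ :=
  F - P[F | sigmaOf X {k}ᶜ]

/-- The Hilbert space of (classes of) square-integrable random variables that are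
measurable with respect to `σ(X) = σ(X_j, j ∈ ℕ)`, as a closed subspace of `L²(P)`. -/
noncomputable abbrev L2X (X : ∀ n, Ω → E n) (P : Measure Ω) : Submodule ℝ (Lp ℝ 2 P) :=
  lpMeas ℝ ℝ (sigmaOf X Set.univ) 2 P

/-- The random variable underlying an element of `L2X X P`. -/
noncomputable def rv {X : ∀ n, Ω → E n} {P : Measure Ω} (F : L2X X P) : Ω → ℝ :=
  ((F : Lp ℝ 2 P) : Ω → ℝ)

/-- The space of square-integrable processes `U = (U_k)` with `σ(X)`-measurable components and
`∑_k 𝔼[U_k²] < ∞`, that is `L²` of the product of counting measure and `P` restricted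
to `σ(X)`. -/
abbrev Proc (X : ∀ n, Ω → E n) (P : Measure Ω) : Type _ :=
  lp (fun _ : ℕ => L2X X P) 2

/-- The subspace of cylindrical random variables: those in `L2X X P` that are measurable with
respect to `σ(X_j, j < n)` for some `n`. -/
def cylindrical (X : ∀ n, Ω → E n) (P : Measure Ω) : Submodule ℝ (L2X X P) where
  carrier := {F | ∃ n : ℕ, AEStronglyMeasurable[sigmaOf X (Set.Iio n)] (F : Lp ℝ 2 P) P}
  zero_mem' := ⟨0, mem_lpMeas_iff_aestronglyMeasurable.mp (zero_mem (lpMeas ℝ ℝ _ 2 P))⟩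
  add_mem' := by
    rintro F G ⟨n, hn⟩ ⟨m, hm⟩
    refine ⟨max n m, mem_lpMeas_iff_aestronglyMeasurable.mp
      ((lpMeas ℝ ℝ (sigmaOf X (Set.Iio (max n m))) 2 P).add_mem ?_ ?_)⟩
    · exact mem_lpMeas_iff_aestronglyMeasurable.mpr
        (hn.mono (sigmaOf_mono X (Set.Iio_subset_Iio (le_max_left n m))))
    · exact mem_lpMeas_iff_aestronglyMeasurable.mpr
        (hm.mono (sigmaOf_mono X (Set.Iio_subset_Iio (le_max_right n m))))
  smul_mem' := by
    rintro c F ⟨n, hn⟩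
    exact ⟨n, mem_lpMeas_iff_aestronglyMeasurable.mp
      ((lpMeas ℝ ℝ (sigmaOf X (Set.Iio n)) 2 P).smul_mem c
        (mem_lpMeas_iff_aestronglyMeasurable.mpr hn))⟩

variable {X : ∀ n, Ω → E n} (hX : ∀ n, Measurable (X n)) (P : Measure Ω) [IsProbabilityMeasure P]

/-- The operator `D_k` on `L2X X P`, by means of the conditional expectation on `L²`;
it agrees with `diffOp`, see `rv_diffL2`. -/
noncomputable def diffL2 (k : ℕ) : L2X X P →ₗ[ℝ] L2X X P :=
  LinearMap.id -
    (Submodule.inclusion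
        (show lpMeas ℝ ℝ (sigmaOf X {k}ᶜ) 2 P ≤ L2X X P from fun _ hF =>
          mem_lpMeas_iff_aestronglyMeasurable.mpr
            ((mem_lpMeas_iff_aestronglyMeasurable.mp hF).mono
              (sigmaOf_mono X (Set.subset_univ _))))) ∘ₗ
      (condExpL2 ℝ ℝ (sigmaOf_le hX {k}ᶜ)).toLinearMap ∘ₗ (L2X X P).subtype

theorem rv_diffL2 (k : ℕ) (F : L2X X P) :
    rv (diffL2 hX P k F) =ᵐ[P] diffOp X P k (rv F) := by
  have h1 := (Lp.memLp (F : Lp ℝ 2 P)).condExpL2_ae_eq_condExp (𝕜 := ℝ) (sigmaOf_le hX {k}ᶜ)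
  rw [Lp.toLp_coeFn] at h1
  have h2 := Lp.coeFn_sub (F : Lp ℝ 2 P)
    (condExpL2 ℝ ℝ (sigmaOf_le hX {k}ᶜ) (F : Lp ℝ 2 P) : Lp ℝ 2 P)
  filter_upwards [h1, h2] with ω h1 h2
  exact h2.trans (congrArg (fun x => (F : Lp ℝ 2 P) ω - x) h1)

theorem diffL2_eq_zero {n k : ℕ} (hk : n ≤ k) {F : L2X X P}
    (hF : AEStronglyMeasurable[sigmaOf X (Set.Iio n)] (F : Lp ℝ 2 P) P) :
    diffL2 hX P k F = 0 := by
  have : Fact (sigmaOf X {k}ᶜ ≤ mΩ) := ⟨sigmaOf_le hX _⟩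
  have hmem : (F : Lp ℝ 2 P) ∈ lpMeas ℝ ℝ (sigmaOf X {k}ᶜ) 2 P :=
    mem_lpMeas_iff_aestronglyMeasurable.mpr (hF.mono (sigmaOf_mono X
      (fun j (hj : j < n) => (lt_of_lt_of_le hj hk).ne)))
  have h := Submodule.orthogonalProjectionOnto_mem_subspace_eq_self
    (K := lpMeas ℝ ℝ (sigmaOf X {k}ᶜ) 2 P) ⟨_, hmem⟩
  apply Subtype.ext
  change (F : Lp ℝ 2 P) - (condExpL2 ℝ ℝ (sigmaOf_le hX {k}ᶜ) (F : Lp ℝ 2 P) : Lp ℝ 2 P) = 0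
  rw [sub_eq_zero]
  exact (congrArg Subtype.val h).symm

/-- The gradient `F ↦ (D_k F)_k` on cylindrical random variables. -/
noncomputable def gradCyl : L2X X P →ₗ.[ℝ] Proc X P where
  domain := cylindrical X P
  toFun :=
    { toFun := fun F => ⟨fun k => diffL2 hX P k F, by
        obtain ⟨n, hn⟩ := F.2
        refine (memℓp_zero ((Set.finite_Iio n).subset fun k hk => ?_)).of_exponent_ge
          zero_le
        by_contra hkn
        exact hk (diffL2_eq_zero hX P (not_lt.mp hkn) hn)⟩
      map_add' := fun F G => by ext1; funext k; exact map_add (diffL2 hX P k) (F : L2X X P) G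
      map_smul' := fun c F => by
        ext1; funext k; exact map_smul (diffL2 hX P k) c (F : L2X X P) }

/-- The Malliavin derivative `D`: the closure of the gradient on cylindrical random variables. -/
noncomputable def malD : L2X X P →ₗ.[ℝ] Proc X P :=
  (gradCyl hX P).closure

/-- The divergence operator `δ`: the Hilbert space adjoint of `D`. -/
noncomputable def malDiv : Proc X P →ₗ.[ℝ] L2X X P :=
  haveI : Fact (sigmaOf X Set.univ ≤ mΩ) := ⟨sigmaOf_le hX _⟩
  (malD hX P).adjoint

/-- The domain of the Ornstein-Uhlenbeck generator: all `F ∈ dom D` with `D F ∈ dom δ`. -/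
noncomputable def ouDomain : Submodule ℝ (L2X X P) :=
  ((malDiv hX P).domain.comap (malD hX P).toFun).map (malD hX P).domain.subtype

/-- The Ornstein-Uhlenbeck generator `L = -δ D`, with its domain `ouDomain`. -/
noncomputable def ouGen : L2X X P →ₗ.[ℝ] L2X X P :=
  -((malDiv hX P).comp ((malD hX P).domRestrict (ouDomain hX P)) (by
      rintro ⟨F, ⟨G, hG, rfl⟩, hF⟩
      exact hG))

/-- The subspace of centered random variables. -/
noncomputable def centered (X : ∀ n, Ω → E n) (P : Measure Ω) [IsProbabilityMeasure P] :
    Submodule ℝ (L2X X P) where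
  carrier := {F | ∫ ω, rv F ω ∂P = 0}
  zero_mem' := by
    change ∫ ω, ((0 : Lp ℝ 2 P) : Ω → ℝ) ω ∂P = 0
    rw [integral_congr_ae (Lp.coeFn_zero ℝ 2 P)]
    simp
  add_mem' := by
    intro F G hF hG
    change ∫ ω, ((F : Lp ℝ 2 P) + (G : Lp ℝ 2 P) : Lp ℝ 2 P) ω ∂P = 0
    rw [integral_congr_ae (Lp.coeFn_add (F : Lp ℝ 2 P) (G : Lp ℝ 2 P))]
    simp only [Pi.add_apply]
    rw [integral_add ((Lp.memLp (F : Lp ℝ 2 P)).integrable one_le_two)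
      ((Lp.memLp (G : Lp ℝ 2 P)).integrable one_le_two)]
    exact (congrArg₂ (· + ·) hF hG).trans (add_zero 0)
  smul_mem' := by
    intro c F hF
    change ∫ ω, (c • (F : Lp ℝ 2 P) : Lp ℝ 2 P) ω ∂P = 0
    rw [integral_congr_ae (Lp.coeFn_smul c (F : Lp ℝ 2 P))]
    simp only [Pi.smul_apply]
    rw [integral_smul]
    exact (congrArg (c • ·) hF).trans (smul_zero c)

/-- The pseudo-inverse `L⁻¹`: the inverse of the restriction of `L` to centered random variables.
Thus `L⁻¹ F` is the unique centered `G ∈ dom L` with `L G = F`. -/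
noncomputable def ouInv : L2X X P →ₗ.[ℝ] L2X X P :=
  ((ouGen hX P).domRestrict (centered X P)).inverse

end Setup

end ProdMalliavin

open ProdMalliavin

open MeasureTheory ProbabilityTheory Filter Topology
open scoped ENNReal NNReal

set_option linter.unusedSectionVars false

namespace ProdMalliavin

/-! ### Conditional expectation and independence. -/

section CondExp

variable {Ω : Type*} {m₁ m₂ m₃ mΩ : MeasurableSpace Ω} {P : Measure Ω} [IsProbabilityMeasure P]

/-! The proof joins Malliavin calculus for independent variables to Stein's method. Write `F_k = 𝔼[F
| 𝒢_k]`, so that `D_k F = F - F_k` exactly.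

Conditional expectations over sub-families of independent variables commute: conditioning on `A` and
then on `B` is conditioning on `A ∩ B`. So each `D_k` is an orthogonal projection commuting with
truncation to the first `n` variables, and `D` is the map `F ↦ (D_k F)_k` on its maximal domain
(`malD_eq_gradMax`). Martingale increments give the Efron–Stein inequality `‖F‖ ≤ ‖D F‖` for
centered `F`. Hence `D` has closed range on centered variables, and the Riesz theorem yields `G =
-L⁻¹F` with `𝔼[F H] = ⟨D G, D H⟩` for all `H` in the domain (`exists_ouInv`).

Take `H = f(F)` with `f` Lipschitz. Since `f(F_k)` is `𝒢_k`-measurable, `D_k` annihilates it, and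
`𝔼[F f(F)] = ∑_k 𝔼[D_k G (f(F) - f(F_k))]` (`hasSum_integral_mul_comp`). Expanding `f` at `F` with
slope `g(F)`, where `g` plays the role of `f'`, gives `𝔼[g(F) - F f(F)] = 𝔼[g(F) (1 - ∑_k D_k G D_k
F)] - ∑_k 𝔼[D_k G · remainder_k]`. The left side is the quantity to be bounded when `f` solves a
Stein equation.

For Wasserstein distance, a smoothed test function gives `|f'| ≤ √(2/π)` and `|f''| ≤ 2`, so the
remainder is at most `(D_k F)²`.

For Kolmogorov distance, `|g| ≤ 1` and the remainder is at most `D_k F (ξ(F) - ξ(F_k))`, where `ξ(w)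
= w f(w) + 1_{w > z}` is nondecreasing with oscillation at most 2. Split `|D_k G| = A_k + B_k` with
`A_k = 𝔼[|D_k G| | 𝒢_k]` and `B_k = D_k |D_k G|`. In the `A_k` part, `ξ(F_k) A_k` is
`𝒢_k`-measurable, hence orthogonal to `D_k F`; what is left sums to `𝔼[ξ(F) ∑_k A_k D_k F]`, which
keeps the absolute value outside the sum. The `B_k` part uses only the oscillation. -/

theorem setIntegral_eq_of_indep {g : Ω → ℝ} (hle₁ : m₁ ≤ mΩ) (hle₂ : m₂ ≤ mΩ)
    (hg : StronglyMeasurable[m₁] g) (hgi : Integrable g P) (hindep : Indep m₁ m₂ P)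
    {s : Set Ω} (hs : MeasurableSet[m₂] s) : ∫ ω in s, g ω ∂P = P.real s * ∫ ω, g ω ∂P := by
  rw [← setIntegral_condExp hle₂ hgi hs,
    setIntegral_congr_ae (hle₂ _ hs) ((condExp_indep_eq hle₁ hle₂ hg hindep).mono fun _ h _ => h)]
  simp

/-- Enlarging the conditioning σ-algebra `m₂` by an independent `m₃` does not change the
conditional expectation of an `m₁`-measurable variable, if `m₂ ≤ m₁` and `m₁`, `m₃` are
independent. -/
theorem condExp_sup_eq_of_indep {g : Ω → ℝ} (hle₁ : m₁ ≤ mΩ) (hle₃ : m₃ ≤ mΩ) (h21 : m₂ ≤ m₁)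
    (hg : StronglyMeasurable[m₁] g) (hindep : Indep m₁ m₃ P) :
    P[g | m₂ ⊔ m₃] =ᵐ[P] P[g | m₂] := by
  by_cases hgi : Integrable g P
  swap; · rw [condExp_of_not_integrable hgi, condExp_of_not_integrable hgi]
  have hle₂ : m₂ ≤ mΩ := h21.trans hle₁
  have hsup : m₂ ⊔ m₃ ≤ mΩ := sup_le hle₂ hle₃
  refine (ae_eq_condExp_of_forall_setIntegral_eq hsup hgi
    (fun s _ _ => integrable_condExp.integrableOn) (fun s hs hfin => ?_)
    (StronglyMeasurable.mono stronglyMeasurable_condExp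
      (le_sup_left : m₂ ≤ m₂ ⊔ m₃)).aestronglyMeasurable).symm
  clear hfin
  have hgen : m₂ ⊔ m₃ = MeasurableSpace.generateFrom
      (Set.image2 (· ∩ ·) {s | MeasurableSet[m₂] s} {s | MeasurableSet[m₃] s}) := by
    refine le_antisymm (sup_le (fun s hs => ?_) fun s hs => ?_)
      (MeasurableSpace.generateFrom_le ?_)
    · exact MeasurableSpace.measurableSet_generateFrom
        ⟨s, hs, Set.univ, MeasurableSet.univ, Set.inter_univ s⟩
    · exact MeasurableSpace.measurableSet_generateFrom
        ⟨Set.univ, MeasurableSet.univ, s, hs, Set.univ_inter s⟩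
    · rintro _ ⟨a, ha, b, hb, rfl⟩
      exact MeasurableSet.inter (le_sup_left (a := m₂) (b := m₃) _ ha)
        (le_sup_right (a := m₂) (b := m₃) _ hb)
  have hpi : IsPiSystem
      (Set.image2 (· ∩ ·) {s | MeasurableSet[m₂] s} {s | MeasurableSet[m₃] s}) := by
    rintro _ ⟨a, ha, b, hb, rfl⟩ _ ⟨c, hc, d, hd, rfl⟩ _
    exact ⟨a ∩ c, MeasurableSet.inter ha hc, b ∩ d, MeasurableSet.inter hb hd,
      Set.inter_inter_inter_comm a c b d⟩
  induction s, hs using MeasurableSpace.induction_on_inter hgen hpi with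
  | empty => simp
  | basic t ht =>
    obtain ⟨a, ha, b, hb, rfl⟩ := ht
    -- The indicator of `a` can be absorbed into `u` because `m₂ ≤ m₁`; the remaining event `b` is
    -- independent of `m₁`.
    have key : ∀ {u : Ω → ℝ}, StronglyMeasurable[m₁] u → Integrable u P →
        ∫ ω in a ∩ b, u ω ∂P = P.real b * ∫ ω in a, u ω ∂P := by
      intro u hu hui
      rw [Set.inter_comm, ← setIntegral_indicator (hle₂ _ ha),
        ← integral_indicator (hle₂ _ ha)]
      exact setIntegral_eq_of_indep hle₁ hle₃ (hu.indicator (h21 _ ha))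
        (hui.indicator (hle₂ _ ha)) hindep hb
    simp only
    rw [key hg hgi, key (stronglyMeasurable_condExp.mono h21) integrable_condExp,
      setIntegral_condExp hle₂ hgi ha]
  | compl t ht ih =>
    have h1 := integral_add_compl (hsup _ ht) hgi
    have h2 := integral_add_compl (hsup _ ht) (integrable_condExp (m := m₂) (f := g) (μ := P))
    rw [integral_condExp hle₂] at h2
    linarith
  | iUnion t hd ht ih =>
    rw [integral_iUnion (fun i => hsup _ (ht i)) hd integrable_condExp.integrableOn,
      integral_iUnion (fun i => hsup _ (ht i)) hd hgi.integrableOn]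
    exact tsum_congr ih

end CondExp

/-! ### Commuting projections on the space of square-integrable functionals. -/

section

variable {Ω : Type*} [mΩ : MeasurableSpace Ω] {E : ℕ → Type*} [∀ n, MeasurableSpace (E n)]
  {X : ∀ n, Ω → E n} {P : Measure Ω} [IsProbabilityMeasure P]

theorem indep_sigmaOf_of_disjoint (hX : ∀ n, Measurable (X n)) (hindep : iIndepFun X P)
    {A B : Set ℕ} (h : Disjoint A B) : Indep (sigmaOf X A) (sigmaOf X B) P :=
  indep_iSup_of_disjoint (fun n => (hX n).comap_le) hindep h

theorem sigmaOf_union (X : ∀ n, Ω → E n) (A B : Set ℕ) :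
    sigmaOf X (A ∪ B) = sigmaOf X A ⊔ sigmaOf X B :=
  iSup_union

/-- Conditional expectations with respect to sub-families of independent variables commute. -/
theorem condExp_condExp_sigmaOf (hX : ∀ n, Measurable (X n)) (hindep : iIndepFun X P)
    (A B : Set ℕ) (f : Ω → ℝ) :
    P[P[f | sigmaOf X A] | sigmaOf X B] =ᵐ[P] P[f | sigmaOf X (A ∩ B)] := by
  -- The variables indexed by `B \ A` are independent of those indexed by `A`, so conditioning an
  -- `A`-measurable variable on them adds nothing.
  have hB : sigmaOf X B = sigmaOf X (A ∩ B) ⊔ sigmaOf X (B \ A) := by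
    rw [← sigmaOf_union, Set.inter_comm, Set.inter_union_sdiff]
  have h1 := condExp_sup_eq_of_indep (P := P) (m₂ := sigmaOf X (A ∩ B)) (sigmaOf_le hX A) (sigmaOf_le hX (B \ A))
    (sigmaOf_mono X Set.inter_subset_left) (stronglyMeasurable_condExp (f := f) (μ := P))
    (indep_sigmaOf_of_disjoint hX hindep Set.disjoint_sdiff_right)
  rw [← hB] at h1
  exact h1.trans (condExp_condExp_of_le (sigmaOf_mono X Set.inter_subset_left) (sigmaOf_le hX A))


/-- The orthogonal projection `F ↦ 𝔼[F | X_j, j ∈ M]` on `L2X X P`. -/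
noncomputable def proj (hX : ∀ n, Measurable (X n)) (P : Measure Ω) [IsProbabilityMeasure P]
    (M : Set ℕ) : L2X X P →L[ℝ] L2X X P :=
  ((lpMeas ℝ ℝ (sigmaOf X M) 2 P).subtypeL ∘L condExpL2 ℝ ℝ (sigmaOf_le hX M) ∘L
    (L2X X P).subtypeL).codRestrict (L2X X P) fun F =>
      mem_lpMeas_iff_aestronglyMeasurable.mpr
        ((lpMeas.aestronglyMeasurable (condExpL2 ℝ ℝ (sigmaOf_le hX M) (F : Lp ℝ 2 P))).mono
          (sigmaOf_mono X (Set.subset_univ M)))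

variable (hX : ∀ n, Measurable (X n))

theorem coe_proj (M : Set ℕ) (F : L2X X P) :
    (proj hX P M F : Lp ℝ 2 P) = condExpL2 ℝ ℝ (sigmaOf_le hX M) (F : Lp ℝ 2 P) := by
  simp only [proj, ContinuousLinearMap.coe_codRestrict_apply, ContinuousLinearMap.comp_apply,
    Submodule.subtypeL_apply]

theorem diffL2_apply (k : ℕ) (F : L2X X P) : diffL2 hX P k F = F - proj hX P {k}ᶜ F := rfl

theorem memLp_rv (F : L2X X P) : MemLp (rv F) 2 P := Lp.memLp _

theorem integrable_rv (F : L2X X P) : Integrable (rv F) P := (memLp_rv F).integrable one_le_two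

theorem rv_ext {F G : L2X X P} (h : rv F =ᵐ[P] rv G) : F = G := Subtype.ext (Lp.ext h)

theorem aestronglyMeasurable_rv (F : L2X X P) : AEStronglyMeasurable[sigmaOf X Set.univ] (rv F) P :=
  mem_lpMeas_iff_aestronglyMeasurable.mp F.2

theorem rv_proj (M : Set ℕ) (F : L2X X P) : rv (proj hX P M F) =ᵐ[P] P[rv F | sigmaOf X M] := by
  have h1 := (Lp.memLp (F : Lp ℝ 2 P)).condExpL2_ae_eq_condExp (𝕜 := ℝ) (sigmaOf_le hX M)
  rw [Lp.toLp_coeFn, ← coe_proj] at h1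
  exact h1

theorem rv_sub (F G : L2X X P) : rv (F - G) =ᵐ[P] rv F - rv G := Lp.coeFn_sub _ _

theorem rv_neg (F : L2X X P) : rv (-F) =ᵐ[P] -rv F := Lp.coeFn_neg _

theorem inner_eq_integral (F G : L2X X P) : inner ℝ F G = ∫ ω, rv F ω * rv G ω ∂P := by
  rw [Submodule.coe_inner, L2.inner_def]
  exact integral_congr_ae (ae_of_all _ fun ω => by simp [rv, mul_comm])

theorem norm_proj_le (M : Set ℕ) (F : L2X X P) : ‖proj hX P M F‖ ≤ ‖F‖ := by
  rw [Submodule.coe_norm, Submodule.coe_norm, coe_proj]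
  exact norm_condExpL2_coe_le (sigmaOf_le hX M) (F : Lp ℝ 2 P)

theorem inner_proj_left (M : Set ℕ) (F G : L2X X P) :
    inner ℝ (proj hX P M F) G = inner ℝ F (proj hX P M G) := by
  rw [Submodule.coe_inner, Submodule.coe_inner, coe_proj, coe_proj]
  exact inner_condExpL2_left_eq_right (sigmaOf_le hX M) (f := (F : Lp ℝ 2 P)) (g := (G : Lp ℝ 2 P))

theorem proj_proj (hindep : iIndepFun X P) (A B : Set ℕ) (F : L2X X P) :
    proj hX P A (proj hX P B F) = proj hX P (A ∩ B) F := by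
  apply rv_ext
  refine (rv_proj hX A _).trans ((condExp_congr_ae (rv_proj hX B F)).trans ?_)
  rw [Set.inter_comm]
  exact (condExp_condExp_sigmaOf hX hindep B A (rv F)).trans (rv_proj hX _ F).symm

theorem proj_eq_self_iff (M : Set ℕ) (F : L2X X P) :
    proj hX P M F = F ↔ AEStronglyMeasurable[sigmaOf X M] (F : Lp ℝ 2 P) P := by
  constructor
  · intro h
    rw [← h, coe_proj]
    exact lpMeas.aestronglyMeasurable _
  · intro h
    apply rv_ext
    refine (rv_proj hX M F).trans ?_
    obtain ⟨g, hg, hFg⟩ := h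
    refine (condExp_congr_ae hFg).trans (EventuallyEq.trans ?_ hFg.symm)
    rw [condExp_of_stronglyMeasurable (sigmaOf_le hX M) hg
      ((integrable_rv F).congr hFg)]

theorem proj_univ (F : L2X X P) : proj hX P Set.univ F = F :=
  (proj_eq_self_iff hX _ F).mpr (aestronglyMeasurable_rv F)

theorem proj_empty {F : L2X X P} (hF : ∫ ω, rv F ω ∂P = 0) : proj hX P ∅ F = 0 := by
  apply rv_ext
  refine (rv_proj hX ∅ F).trans ?_
  have : sigmaOf X ∅ = ⊥ := by simp [sigmaOf]
  rw [this, condExp_bot, hF]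
  exact (Lp.coeFn_zero ℝ 2 P).symm

theorem mem_cylindrical_iff (F : L2X X P) :
    F ∈ cylindrical X P ↔ ∃ n, proj hX P (Set.Iio n) F = F :=
  exists_congr fun _ => (proj_eq_self_iff hX _ F).symm

/-- Projections onto an increasing sequence of closed subspaces converge in `L²` to some `y`, while
Lévy's upward theorem gives almost sure convergence to `F`. Both imply convergence in measure, so `y
= F`. -/
theorem tendsto_proj (F : L2X X P) :
    Tendsto (fun n => proj hX P (Set.Iio n) F) atTop (𝓝 F) := by
  have hfact : ∀ n, Fact (sigmaOf X (Set.Iio n) ≤ mΩ) := fun n => ⟨sigmaOf_le hX _⟩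
  let U : ℕ → Submodule ℝ (Lp ℝ 2 P) := fun n => lpMeas ℝ ℝ (sigmaOf X (Set.Iio n)) 2 P
  have hU : Monotone U := fun n m hnm G hG => mem_lpMeas_iff_aestronglyMeasurable.mpr
    ((mem_lpMeas_iff_aestronglyMeasurable.mp hG).mono
      (sigmaOf_mono X (Set.Iio_subset_Iio hnm)))
  have hlim := Submodule.starProjection_tendsto_closure_iSup U hU (F : Lp ℝ 2 P)
  set y := (⨆ i, U i).topologicalClosure.starProjection (F : Lp ℝ 2 P)
  have hco : ∀ n, (U n).starProjection (F : Lp ℝ 2 P) = (proj hX P (Set.Iio n) F : Lp ℝ 2 P) :=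
    fun n => rfl
  simp_rw [hco] at hlim
  rw [tendsto_subtype_rng]
  suffices y = (F : Lp ℝ 2 P) by rwa [← this]
  let ℱ : Filtration ℕ mΩ :=
    { seq := fun n => sigmaOf X (Set.Iio n)
      mono' := fun n m hnm => sigmaOf_mono X (Set.Iio_subset_Iio hnm)
      le' := fun n => sigmaOf_le hX _ }
  have hsup : ⨆ n, ℱ n = sigmaOf X Set.univ := by
    refine le_antisymm (iSup_le fun n => sigmaOf_mono X (Set.subset_univ _))
      (iSup₂_le fun j _ => ?_)
    exact le_iSup_of_le (j + 1) (le_iSup₂_of_le j (Nat.lt_succ_self j) le_rfl)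
  have hae := tendsto_ae_condExp (μ := P) (ℱ := ℱ) (rv F)
  rw [hsup] at hae
  have h1 : TendstoInMeasure P (fun n => rv (proj hX P (Set.Iio n) F)) atTop (rv F) := by
    refine tendstoInMeasure_of_tendsto_ae (fun n => (memLp_rv _).1) ?_
    have h2 : ∀ᵐ ω ∂P, ∀ n, rv (proj hX P (Set.Iio n) F) ω = (P[rv F | ℱ n]) ω :=
      ae_all_iff.mpr fun n => rv_proj hX _ F
    have h3 : P[rv F | sigmaOf X Set.univ] =ᵐ[P] rv F := by
      rw [← proj_univ hX F]
      exact (condExp_congr_ae (by rw [proj_univ])).trans (rv_proj hX Set.univ _).symm |>.trans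
        (by rw [proj_univ])
    filter_upwards [hae, h2, h3] with ω hω h2 h3
    rw [← h3]
    exact hω.congr fun n => (h2 n).symm
  have h2 : TendstoInMeasure P (fun n => rv (proj hX P (Set.Iio n) F)) atTop (y : Ω → ℝ) :=
    tendstoInMeasure_of_tendsto_Lp hlim
  exact Lp.ext (tendstoInMeasure_ae_unique h2 h1)

end

/-! ### The gradient on its maximal domain and the Efron–Stein inequality. -/

section

variable {Ω : Type*} [mΩ : MeasurableSpace Ω] {E : ℕ → Type*} [∀ n, MeasurableSpace (E n)]
  {X : ∀ n, Ω → E n} (hX : ∀ n, Measurable (X n)) {P : Measure Ω} [IsProbabilityMeasure P]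

theorem completeSpace_L2X (hX : ∀ n, Measurable (X n)) : CompleteSpace (L2X X P) :=
  haveI : Fact (sigmaOf X Set.univ ≤ mΩ) := ⟨sigmaOf_le hX _⟩
  inferInstance

theorem continuous_diffL2 (k : ℕ) : Continuous (diffL2 hX P k) := by
  have : ⇑(diffL2 hX P k) = fun F => F - proj hX P {k}ᶜ F := funext (diffL2_apply hX k)
  rw [this]
  fun_prop

theorem inner_diffL2_left (k : ℕ) (F G : L2X X P) :
    inner ℝ (diffL2 hX P k F) G = inner ℝ F (diffL2 hX P k G) := by
  simp only [diffL2_apply, inner_sub_left, inner_sub_right, inner_proj_left]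

theorem diffL2_proj (hindep : iIndepFun X P) (k : ℕ) (M : Set ℕ) (F : L2X X P) :
    diffL2 hX P k (proj hX P M F) = proj hX P M (diffL2 hX P k F) := by
  simp only [diffL2_apply, map_sub, proj_proj hX hindep, Set.inter_comm]

theorem diffL2_proj_of_notMem (hindep : iIndepFun X P) {k : ℕ} {M : Set ℕ} (h : k ∉ M)
    (F : L2X X P) : diffL2 hX P k (proj hX P M F) = 0 := by
  rw [diffL2_apply, proj_proj hX hindep,
    Set.inter_eq_right.mpr (Set.subset_compl_singleton_iff.mpr h), sub_self]

theorem diffL2_diffL2 (hindep : iIndepFun X P) (k : ℕ) (F : L2X X P) :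
    diffL2 hX P k (diffL2 hX P k F) = diffL2 hX P k F := by
  conv_lhs => rw [diffL2_apply hX k F, map_sub,
    diffL2_proj_of_notMem hX hindep (M := {k}ᶜ) (by simp), sub_zero]

/-- `D_k` is symmetric and idempotent, so `‖D_k F‖² = ⟨F, D_k F⟩` and Cauchy–Schwarz applies. -/
theorem norm_diffL2_le (hindep : iIndepFun X P) (k : ℕ) (F : L2X X P) :
    ‖diffL2 hX P k F‖ ≤ ‖F‖ := by
  by_cases h : ‖diffL2 hX P k F‖ = 0
  · rw [h]; exact norm_nonneg _
  refine le_of_mul_le_mul_left ?_ (lt_of_le_of_ne (norm_nonneg _) (Ne.symm h))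
  rw [← real_inner_self_eq_norm_mul_norm, inner_diffL2_left, diffL2_diffL2 hX hindep, mul_comm]
  exact real_inner_le_norm _ _

/-- The gradient `F ↦ (D_k F)_k` on its maximal domain. -/
noncomputable def gradMax (hX : ∀ n, Measurable (X n)) (P : Measure Ω) [IsProbabilityMeasure P] :
    L2X X P →ₗ.[ℝ] Proc X P where
  domain :=
    { carrier := {F | Memℓp (fun k => diffL2 hX P k F) 2}
      zero_mem' := by
        simp only [Set.mem_ofPred_eq, map_zero]
        exact zero_memℓp
      add_mem' := fun {F G} hF hG => by
        simp only [Set.mem_ofPred_eq, map_add]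
        exact hF.add hG
      smul_mem' := fun c F hF => by
        simp only [Set.mem_ofPred_eq, map_smul]
        exact hF.const_smul c }
  toFun :=
    { toFun := fun F => ⟨fun k => diffL2 hX P k F, F.2⟩
      map_add' := fun F G => by ext1; funext k; exact map_add (diffL2 hX P k) (F : L2X X P) G
      map_smul' := fun c F => by
        ext1; funext k; exact map_smul (diffL2 hX P k) c (F : L2X X P) }

theorem mem_gradMax_domain (F : L2X X P) :
    F ∈ (gradMax hX P).domain ↔ Memℓp (fun k => diffL2 hX P k F) 2 := Iff.rfl

theorem gradMax_apply (F : (gradMax hX P).domain) (k : ℕ) :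
    gradMax hX P F k = diffL2 hX P k F := rfl

theorem mem_graph_gradMax (x : L2X X P × Proc X P) :
    x ∈ (gradMax hX P).graph ↔ ∀ k, diffL2 hX P k x.1 = x.2 k := by
  rw [LinearPMap.mem_graph_iff]
  constructor
  · rintro ⟨F, hF, hU⟩ k
    rw [← hF, ← hU, gradMax_apply]
  · intro h
    have hm : x.1 ∈ (gradMax hX P).domain := by
      rw [mem_gradMax_domain, funext h]
      exact lp.memℓp x.2
    exact ⟨⟨x.1, hm⟩, rfl, lp.ext (funext h)⟩

/-- Each `D_k` is continuous, so the graph is an intersection of closed sets, one for each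
coordinate. -/
theorem isClosed_gradMax : (gradMax hX P).IsClosed := by
  have : ((gradMax hX P).graph : Set (L2X X P × Proc X P)) =
      ⋂ k, {x | diffL2 hX P k x.1 = x.2 k} := by
    ext x
    rw [Set.mem_iInter]
    exact mem_graph_gradMax hX x
  rw [LinearPMap.IsClosed, this]
  exact isClosed_iInter fun k => isClosed_eq ((continuous_diffL2 hX k).comp continuous_fst)
    ((lp.evalCLM ℝ (fun _ : ℕ => L2X X P) 2 k).continuous.comp continuous_snd)

theorem gradCyl_le_gradMax : gradCyl hX P ≤ gradMax hX P := by
  refine LinearPMap.le_of_le_graph fun x hx => ?_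
  rw [LinearPMap.mem_graph_iff] at hx
  obtain ⟨F, hF, hU⟩ := hx
  rw [mem_graph_gradMax]
  intro k
  rw [← hF, ← hU]
  rfl

/-- Componentwise conditioning on `X_j, j < n`, converges to the identity on processes. -/
theorem tendsto_of_proj (U : Proc X P) (V : ℕ → Proc X P)
    (hV : ∀ n k, V n k = proj hX P (Set.Iio n) (U k)) : Tendsto V atTop (𝓝 U) := by
  have h2 : (0 : ℝ) < (2 : ℝ≥0∞).toReal := by simp
  have hsum : Summable fun k => ‖U k‖ ^ 2 := by
    have := (lp.memℓp U).summable h2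
    simpa using this
  rw [tendsto_iff_norm_sub_tendsto_zero]
  have hsq : Tendsto (fun n => ‖V n - U‖ ^ 2) atTop (𝓝 0) := by
    have hn : ∀ n, ‖V n - U‖ ^ 2 = ∑' k, ‖proj hX P (Set.Iio n) (U k) - U k‖ ^ 2 := by
      intro n
      have := lp.norm_rpow_eq_tsum h2 (V n - U)
      simp only [ENNReal.toReal_ofNat, Real.rpow_ofNat, lp.coeFn_sub, Pi.sub_apply, hV] at this
      exact this
    simp_rw [hn]
    have h0 : (0 : ℝ) = ∑' _ : ℕ, (0 : ℝ) := tsum_zero.symm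
    rw [h0]
    -- The dominating factor 4 comes from `‖proj U_k - U_k‖ ≤ 2 ‖U_k‖`, squared.
    refine tendsto_tsum_of_dominated_convergence (bound := fun k => 4 * ‖U k‖ ^ 2)
      (hsum.mul_left 4) (fun k => ?_) (Eventually.of_forall fun n k => ?_)
    · have := tendsto_iff_norm_sub_tendsto_zero.mp (tendsto_proj hX (U k))
      simpa using this.pow 2
    · rw [Real.norm_of_nonneg (sq_nonneg _)]
      have h1 : ‖proj hX P (Set.Iio n) (U k) - U k‖ ≤ 2 * ‖U k‖ := by
        refine (norm_sub_le _ _).trans ?_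
        linarith [norm_proj_le hX (Set.Iio n) (U k)]
      nlinarith [norm_nonneg (proj hX P (Set.Iio n) (U k) - U k)]
  have := hsq.sqrt
  simpa [Real.sqrt_sq (norm_nonneg _)] using this

/-- The Malliavin derivative is the gradient on its maximal domain. -/
theorem malD_eq_gradMax (hindep : iIndepFun X P) : malD hX P = gradMax hX P := by
  have hcl : (gradCyl hX P).IsClosable :=
    LinearPMap.isClosable_iff_exists_closed_extension.mpr
      ⟨_, isClosed_gradMax hX, gradCyl_le_gradMax hX⟩
  apply LinearPMap.eq_of_eq_graph
  rw [malD, ← hcl.graph_closure_eq_closure_graph]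
  refine le_antisymm (Submodule.topologicalClosure_minimal _
    (LinearPMap.le_graph_of_le (gradCyl_le_gradMax hX)) (isClosed_gradMax hX)) ?_
  rintro ⟨F, U⟩ hx
  rw [mem_graph_gradMax] at hx
  have hcyl : ∀ n, proj hX P (Set.Iio n) F ∈ (gradCyl hX P).domain := fun n =>
    (mem_cylindrical_iff hX _).mpr ⟨n, by rw [proj_proj hX hindep, Set.inter_self]⟩
  -- Truncations of `F` are cylindrical, and their gradients are the truncated gradients because
  -- `D_k` commutes with truncation.
  have hlim : Tendsto (fun n => gradCyl hX P ⟨proj hX P (Set.Iio n) F, hcyl n⟩) atTop (𝓝 U) := by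
    refine tendsto_of_proj hX U _ fun n k => ?_
    rw [← hx k]
    exact diffL2_proj hX hindep k _ F
  exact mem_closure_of_tendsto ((tendsto_proj hX F).prodMk_nhds hlim)
    (Eventually.of_forall fun n => LinearPMap.mem_graph _ ⟨_, hcyl n⟩)

/-- Density of the domain is what makes the adjoint `δ` satisfy the duality relation. -/
theorem dense_gradMax_domain (hindep : iIndepFun X P) :
    Dense ((gradMax hX P).domain : Set (L2X X P)) := by
  intro F
  refine mem_closure_of_tendsto (tendsto_proj hX F) (Eventually.of_forall fun n => ?_)
  exact (gradCyl_le_gradMax hX).1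
    ((mem_cylindrical_iff hX _).mpr ⟨n, by rw [proj_proj hX hindep, Set.inter_self]⟩)

/-- The martingale increment `𝔼[F | X_0, …, X_n] - 𝔼[F | X_0, …, X_{n-1}]` is the projection of `D_n
F` onto the first `n + 1` variables, hence no longer than `D_n F`. Distinct increments are
orthogonal, so Pythagoras and induction give the sum. -/
theorem norm_proj_Iio_sq_le (hindep : iIndepFun X P) {F : L2X X P} (hF : proj hX P ∅ F = 0)
    (n : ℕ) : ‖proj hX P (Set.Iio n) F‖ ^ 2 ≤ ∑ k ∈ Finset.range n, ‖diffL2 hX P k F‖ ^ 2 := by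
  induction n with
  | zero =>
    simp [hF]
  | succ n ih =>
    have hset : Set.Iio (n + 1) ∩ {n}ᶜ = Set.Iio n := by
      ext j
      simp only [Set.mem_inter_iff, Set.mem_Iio, Set.mem_compl_iff, Set.mem_singleton_iff]
      omega
    have hset2 : Set.Iio n ∩ Set.Iio (n + 1) = Set.Iio n :=
      Set.inter_eq_left.mpr (Set.Iio_subset_Iio n.le_succ)
    have hsplit : proj hX P (Set.Iio (n + 1)) F =
        proj hX P (Set.Iio n) F + proj hX P (Set.Iio (n + 1)) (diffL2 hX P n F) := by
      rw [diffL2_apply, map_sub, proj_proj hX hindep, hset]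
      abel
    have horth : inner ℝ (proj hX P (Set.Iio n) F)
        (proj hX P (Set.Iio (n + 1)) (diffL2 hX P n F)) = 0 := by
      rw [inner_proj_left, proj_proj hX hindep, hset2, ← diffL2_proj hX hindep,
        diffL2_proj_of_notMem hX hindep (by simp), inner_zero_right]
    rw [hsplit, Finset.sum_range_succ, sq,
      norm_add_sq_eq_norm_sq_add_norm_sq_of_inner_eq_zero _ _ horth, ← sq, ← sq]
    refine add_le_add ih ?_
    gcongr
    exact norm_proj_le hX _ _

/-- The Poincaré (Efron–Stein) inequality. -/
theorem norm_le_norm_gradMax (hindep : iIndepFun X P) (F : (gradMax hX P).domain)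
    (hF : proj hX P ∅ (F : L2X X P) = 0) : ‖(F : L2X X P)‖ ≤ ‖gradMax hX P F‖ := by
  have h2 : (0 : ℝ) < (2 : ℝ≥0∞).toReal := by simp
  refine le_of_sq_le_sq ?_ (norm_nonneg _)
  refine le_of_tendsto ((tendsto_proj hX (F : L2X X P)).norm.pow 2)
    (Eventually.of_forall fun n => ?_)
  refine (norm_proj_Iio_sq_le hX hindep hF n).trans ?_
  have := lp.sum_rpow_le_norm_rpow h2 (gradMax hX P F) (Finset.range n)
  simpa [gradMax_apply] using this

end

/-! ### Hilbert space lemmas on inverting `-T†T`. -/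

section Abstract

open scoped InnerProductSpace

variable {H U : Type*} [NormedAddCommGroup H] [InnerProductSpace ℝ H]
  [NormedAddCommGroup U] [InnerProductSpace ℝ U]

/-- Riesz representation for the form `⟪T G, T K⟫` of a coercive operator with closed range. -/
theorem exists_inner_apply_eq_of_isClosed_range [CompleteSpace U] {C : Submodule ℝ H}
    (T : C →ₗ[ℝ] U) (hT : ∀ G : C, ‖(G : H)‖ ≤ ‖T G‖)
    (hcl : IsClosed (LinearMap.range T : Set U)) (F : H) :
    ∃ G : C, ∀ K : C, ⟪F, (K : H)⟫_ℝ = ⟪T G, T K⟫_ℝ := by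
  have hinj : Function.Injective T := by
    rw [← LinearMap.ker_eq_bot, LinearMap.ker_eq_bot']
    intro G hG
    have := hT G
    rw [hG, norm_zero] at this
    exact Subtype.ext (norm_le_zero_iff.mp this)
  have : CompleteSpace (LinearMap.range T) := hcl.completeSpace_coe
  let e := LinearEquiv.ofInjective T hinj
  have he : ∀ u, T (e.symm u) = u := fun u => congrArg Subtype.val (e.apply_symm_apply u)
  -- The functional `T K ↦ ⟪F, K⟫` on the range is bounded by coercivity; the closed range is a
  -- Hilbert space, so Riesz applies there.
  let ℓ₀ : LinearMap.range T →ₗ[ℝ] ℝ := (innerₛₗ ℝ F) ∘ₗ C.subtype ∘ₗ e.symm.toLinearMap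
  have hℓ : ∀ u, ‖ℓ₀ u‖ ≤ ‖F‖ * ‖u‖ := by
    intro u
    refine (norm_inner_le_norm (𝕜 := ℝ) F _).trans ?_
    refine mul_le_mul_of_nonneg_left ((hT (e.symm u)).trans (le_of_eq ?_)) (norm_nonneg _)
    exact congrArg norm (he u)
  let ℓ := ℓ₀.mkContinuous ‖F‖ hℓ
  let u := (InnerProductSpace.toDual ℝ (LinearMap.range T)).symm ℓ
  have hu : ∀ v, ⟪u, v⟫_ℝ = ℓ₀ v := fun v => InnerProductSpace.toDual_symm_apply
  refine ⟨e.symm u, fun K => ?_⟩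
  have h1 := hu (e K)
  have h2 : ℓ₀ (e K) = ⟪F, (K : H)⟫_ℝ := by
    change ⟪F, ((e.symm (e K) : C) : H)⟫_ℝ = _
    rw [e.symm_apply_apply]
  rw [← h2, ← h1, he]
  rfl

/-- Inverting `-T†T` on a subspace `C` on which `T` is coercive, from the weak equation. -/
theorem inverse_neg_adjoint_comp_apply [CompleteSpace H] (T : H →ₗ.[ℝ] U)
    (hdense : Dense (T.domain : Set H)) (C S : Submodule ℝ H)
    (hS : ∀ K, K ∈ S ↔ ∃ hK : K ∈ T.domain, T ⟨K, hK⟩ ∈ T.adjoint.domain)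
    (hcomp : ∀ x : (T.domRestrict S).domain, T.domRestrict S x ∈ T.adjoint.domain)
    (hC : ∀ K : T.domain, (K : H) ∈ C → ‖(K : H)‖ ≤ ‖T K‖) {F : H} (G : T.domain)
    (hGC : (G : H) ∈ C) (hG : ∀ K : T.domain, ⟪F, (K : H)⟫_ℝ = ⟪T G, T K⟫_ℝ) :
    ∃ hF : F ∈ ((-(T.adjoint.comp (T.domRestrict S) hcomp)).domRestrict C).inverse.domain,
      ((-(T.adjoint.comp (T.domRestrict S) hcomp)).domRestrict C).inverse ⟨F, hF⟩ = -(G : H) := by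
  have hGdiv : T G ∈ T.adjoint.domain := LinearPMap.mem_adjoint_domain_of_exists _ ⟨F, hG⟩
  have hGS : (G : H) ∈ S := (hS _).mpr ⟨G.2, hGdiv⟩
  set L := -(T.adjoint.comp (T.domRestrict S) hcomp) with hL
  have hval : ∀ (K : L.domain) (hK : (K : H) ∈ T.domain)
      (hK' : T ⟨K, hK⟩ ∈ T.adjoint.domain), L K = -T.adjoint ⟨T ⟨K, hK⟩, hK'⟩ :=
    fun K hK hK' => rfl
  -- `LinearPMap.inverse` is a genuine inverse only for a trivial kernel. If `T†T K = 0`, pairing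
  -- with `K` gives `T K = 0`, and coercivity gives `K = 0`.
  have hker : LinearMap.ker (L.domRestrict C).toFun = ⊥ := by
    rw [LinearMap.ker_eq_bot']
    rintro ⟨K, hKC, hKL⟩ hK0
    obtain ⟨hKm, hKdiv⟩ := (hS K).mp hKL.1
    have h0 : L ⟨K, hKL⟩ = 0 := hK0
    rw [hval _ hKm hKdiv, neg_eq_zero] at h0
    have h1 := LinearPMap.adjoint_isFormalAdjoint hdense ⟨T ⟨K, hKm⟩, hKdiv⟩ ⟨K, hKm⟩
    rw [h0, inner_zero_left] at h1
    have h5 := hC ⟨K, hKm⟩ hKC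
    have h3 : T ⟨K, hKm⟩ = 0 := inner_self_eq_zero.mp h1.symm
    rw [h3, norm_zero] at h5
    exact Subtype.ext (norm_le_zero_iff.mp h5)
  let x : (L.domRestrict C).domain := -⟨(G : H), hGC, hGS, G.2⟩
  have hx : L.domRestrict C x = F := by
    have h1 : L.domRestrict C x = -L ⟨G, hGS, G.2⟩ := map_neg (L.domRestrict C).toFun _
    rw [h1, hval _ G.2 hGdiv, neg_neg]
    exact LinearPMap.adjoint_apply_eq hdense _ hG
  have hF : F ∈ (L.domRestrict C).inverse.domain := by
    rw [LinearPMap.inverse_domain]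
    exact ⟨x, hx⟩
  exact ⟨hF, LinearPMap.inverse_apply_eq hker (y := ⟨F, hF⟩) hx⟩

end Abstract

/-! ### Existence of `L⁻¹` on centered variables. -/

section

variable {Ω : Type*} [mΩ : MeasurableSpace Ω] {E : ℕ → Type*} [∀ n, MeasurableSpace (E n)]
  {X : ∀ n, Ω → E n} (hX : ∀ n, Measurable (X n)) {P : Measure Ω} [IsProbabilityMeasure P]

theorem mem_centered_iff (F : L2X X P) : F ∈ centered X P ↔ proj hX P ∅ F = 0 := by
  refine ⟨fun h => proj_empty hX h, fun h => ?_⟩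
  change ∫ ω, rv F ω ∂P = 0
  have h1 := integral_congr_ae (rv_proj hX ∅ F)
  rw [integral_condExp (sigmaOf_le hX ∅), h] at h1
  rw [← h1, ← integral_zero Ω ℝ (μ := P)]
  exact integral_congr_ae (Lp.coeFn_zero ℝ 2 P)

theorem sub_proj_empty_mem (hindep : iIndepFun X P) (F : L2X X P) :
    F - proj hX P ∅ F ∈ centered X P := by
  rw [mem_centered_iff hX, map_sub, proj_proj hX hindep, Set.inter_self, sub_self]

theorem isClosed_centered (hX : ∀ n, Measurable (X n)) :
    IsClosed (centered X P : Set (L2X X P)) := by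
  have : (centered X P : Set (L2X X P)) = {F | proj hX P ∅ F = 0} :=
    Set.ext (mem_centered_iff hX)
  rw [this]
  exact isClosed_eq (proj hX P ∅).continuous continuous_const

/-- The gradient on centered random variables, on its maximal domain. -/
noncomputable def gradCentered (hX : ∀ n, Measurable (X n)) (P : Measure Ω)
    [IsProbabilityMeasure P] :
    ↥((centered X P) ⊓ (gradMax hX P).domain) →ₗ[ℝ] Proc X P :=
  ((gradMax hX P).domRestrict (centered X P)).toFun

theorem norm_le_norm_gradCentered (hindep : iIndepFun X P)
    (F : ↥((centered X P) ⊓ (gradMax hX P).domain)) :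
    ‖(F : L2X X P)‖ ≤ ‖gradCentered hX P F‖ :=
  norm_le_norm_gradMax hX hindep ⟨F, F.2.2⟩ ((mem_centered_iff hX _).mp F.2.1)

/-- If the gradients converge, the Efron–Stein inequality makes the underlying variables Cauchy, and
continuity of each `D_k` identifies the gradient of their limit. -/
theorem isClosed_range_gradCentered (hindep : iIndepFun X P) :
    IsClosed (LinearMap.range (gradCentered hX P) : Set (Proc X P)) := by
  have := completeSpace_L2X (P := P) hX
  refine IsSeqClosed.isClosed fun U V hU hV => ?_
  choose F hF using hU
  have hcau : CauchySeq fun n => ((F n : _) : L2X X P) := by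
    rw [Metric.cauchySeq_iff]
    intro ε hε
    obtain ⟨N, hN⟩ := Metric.cauchySeq_iff.mp hV.cauchySeq ε hε
    refine ⟨N, fun m hm n hn => lt_of_le_of_lt ?_ (hN m hm n hn)⟩
    rw [dist_eq_norm, dist_eq_norm, ← hF m, ← hF n, ← map_sub]
    exact norm_le_norm_gradCentered hX hindep (F m - F n)
  obtain ⟨G, hG⟩ := cauchySeq_tendsto_of_complete hcau
  have hGc : G ∈ centered X P :=
    (isClosed_centered hX).mem_of_tendsto hG (Eventually.of_forall fun n => (F n).2.1)
  have hD : ∀ k, diffL2 hX P k G = V k := by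
    intro k
    have h1 := ((continuous_diffL2 (P := P) hX k).tendsto G).comp hG
    have h2 := ((lp.evalCLM ℝ (fun _ : ℕ => L2X X P) 2 k).continuous.tendsto V).comp hV
    refine tendsto_nhds_unique h1 (h2.congr fun n => ?_)
    simp only [Function.comp_apply]
    rw [← hF n]
    rfl
  have hGd : G ∈ (gradMax hX P).domain := by
    rw [mem_gradMax_domain, funext hD]
    exact lp.memℓp V
  exact ⟨⟨G, hGc, hGd⟩, lp.ext (funext fun k => hD k)⟩

/-- The weak form of the equation `δ D G = F`. -/
theorem exists_inner_gradMax_eq (hindep : iIndepFun X P) {F : L2X X P} (hF : F ∈ centered X P) :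
    ∃ G : (gradMax hX P).domain, (G : L2X X P) ∈ centered X P ∧
      ∀ H : (gradMax hX P).domain,
        inner ℝ F (H : L2X X P) = inner ℝ (gradMax hX P G) (gradMax hX P H) := by
  have := completeSpace_L2X (P := P) hX
  obtain ⟨G, hG⟩ := exists_inner_apply_eq_of_isClosed_range (gradCentered hX P)
    (norm_le_norm_gradCentered hX hindep) (isClosed_range_gradCentered hX hindep) F
  refine ⟨⟨G, G.2.2⟩, G.2.1, fun H => ?_⟩
  -- Riesz only tests against centered variables. Subtracting the mean of `H` changes neither its
  -- gradient nor its inner product with the centered `F`.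
  have hHd : ∀ k, diffL2 hX P k ((H : L2X X P) - proj hX P ∅ H) = diffL2 hX P k H := by
    intro k
    rw [map_sub, diffL2_proj_of_notMem hX hindep (Set.notMem_empty k), sub_zero]
  have hH' : (H : L2X X P) - proj hX P ∅ H ∈ (gradMax hX P).domain := by
    rw [mem_gradMax_domain, funext hHd]
    exact H.2
  have h1 := hG ⟨(H : L2X X P) - proj hX P ∅ H, sub_proj_empty_mem hX hindep _, hH'⟩
  have h2 : inner ℝ F ((H : L2X X P) - proj hX P ∅ H) = inner ℝ F (H : L2X X P) := by
    rw [inner_sub_right, ← inner_proj_left, (mem_centered_iff hX F).mp hF, inner_zero_left,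
      sub_zero]
  have h3 : gradCentered hX P
      ⟨(H : L2X X P) - proj hX P ∅ H, sub_proj_empty_mem hX hindep _, hH'⟩ = gradMax hX P H :=
    lp.ext (funext hHd)
  rw [h3] at h1
  exact h2.symm.trans h1

/-- The pseudo-inverse `L⁻¹` is everywhere defined on centered random variables, and
`G = -L⁻¹ F` satisfies `𝔼[F H] = ⟨D G, D H⟩`. -/
theorem exists_ouInv (hindep : iIndepFun X P) {F : L2X X P} (hF : F ∈ centered X P) :
    ∃ (hFL : F ∈ (ouInv hX P).domain) (G : (gradMax hX P).domain),
      ouInv hX P ⟨F, hFL⟩ = -(G : L2X X P) ∧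
      ∀ H : (gradMax hX P).domain,
        inner ℝ F (H : L2X X P) = inner ℝ (gradMax hX P G) (gradMax hX P H) := by
  have := completeSpace_L2X (P := P) hX
  obtain ⟨G, hGc, hG⟩ := exists_inner_gradMax_eq hX hindep hF
  -- Stated for a variable `T` so that the equality of `malD` and `gradMax` can be substituted
  -- without rewriting inside types that depend on the operator's domain.
  have key : ∀ T : L2X X P →ₗ.[ℝ] Proc X P, T = gradMax hX P → ∃ G' : T.domain,
      (G' : L2X X P) = G ∧ (Dense (T.domain : Set (L2X X P))) ∧
      (∀ K : T.domain, (K : L2X X P) ∈ centered X P → ‖(K : L2X X P)‖ ≤ ‖T K‖) ∧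
      ∀ K : T.domain, inner ℝ F (K : L2X X P) = inner ℝ (T G') (T K) := by
    rintro T rfl
    exact ⟨G, rfl, dense_gradMax_domain hX hindep,
      fun K hK => norm_le_norm_gradMax hX hindep K ((mem_centered_iff hX _).mp hK), hG⟩
  obtain ⟨G', hG'G, hdense, hpoinc, hG'⟩ := key (malD hX P) (malD_eq_gradMax hX hindep)
  have hmem : ∀ K : L2X X P, K ∈ ouDomain hX P ↔ ∃ hK : K ∈ (malD hX P).domain,
      malD hX P ⟨K, hK⟩ ∈ (malD hX P).adjoint.domain := by
    intro K
    constructor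
    · rintro ⟨K', hK', rfl⟩
      exact ⟨K'.2, hK'⟩
    · rintro ⟨hK, hK'⟩
      exact ⟨⟨K, hK⟩, hK', rfl⟩
  obtain ⟨hFL, hval⟩ := inverse_neg_adjoint_comp_apply (malD hX P) hdense (centered X P)
    (ouDomain hX P) hmem (by
      rintro ⟨K, hK, hK'⟩
      exact ((hmem K).mp hK).2) hpoinc G' (by rw [hG'G]; exact hGc) hG'
  rw [hG'G] at hval
  exact ⟨hFL, G, hval, hG⟩

end

/-! ### Integration by parts against Lipschitz functions of `F`. -/

section

variable {Ω : Type*} [mΩ : MeasurableSpace Ω] {E : ℕ → Type*} [∀ n, MeasurableSpace (E n)]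
  {X : ∀ n, Ω → E n} (hX : ∀ n, Measurable (X n)) {P : Measure Ω} [IsProbabilityMeasure P]

theorem memLp_comp_lipschitz {f : ℝ → ℝ} {K : ℝ≥0} (hf : LipschitzWith K f) {Y : Ω → ℝ}
    (hY : MemLp Y 2 P) : MemLp (fun ω => f (Y ω)) 2 P := by
  have h1 : MemLp (fun ω => f (Y ω) - f 0) 2 P := by
    refine hY.of_le_mul (c := K)
      ((hf.continuous.comp_aestronglyMeasurable hY.1).sub aestronglyMeasurable_const)
      (ae_of_all _ fun ω => ?_)
    simpa using hf.norm_sub_le (Y ω) 0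
  convert h1.add (memLp_const (f 0)) using 1
  ext ω
  simp

theorem exists_rv_eq {Y : Ω → ℝ} (hY : MemLp Y 2 P)
    (hm : AEStronglyMeasurable[sigmaOf X Set.univ] Y P) : ∃ F : L2X X P, rv F =ᵐ[P] Y :=
  ⟨⟨hY.toLp Y, mem_lpMeas_iff_aestronglyMeasurable.mpr (hm.congr hY.coeFn_toLp.symm)⟩,
    hY.coeFn_toLp⟩

theorem exists_rv_comp_eq {f : ℝ → ℝ} {K : ℝ≥0} (hf : LipschitzWith K f) (F : L2X X P) :
    ∃ Y : L2X X P, rv Y =ᵐ[P] fun ω => f (rv F ω) :=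
  exists_rv_eq (memLp_comp_lipschitz hf (memLp_rv F))
    (hf.continuous.comp_aestronglyMeasurable (aestronglyMeasurable_rv F))

theorem proj_comp_eq_self {f : ℝ → ℝ} (hf : Continuous f) {M : Set ℕ} {F Y : L2X X P}
    (hY : rv Y =ᵐ[P] fun ω => f (rv (proj hX P M F) ω)) : proj hX P M Y = Y := by
  rw [proj_eq_self_iff]
  have h1 : AEStronglyMeasurable[sigmaOf X M] (rv (proj hX P M F)) P :=
    (stronglyMeasurable_condExp.aestronglyMeasurable).congr (rv_proj hX M F).symm
  exact (hf.comp_aestronglyMeasurable h1).congr hY.symm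

theorem rv_diffL2_ae (k : ℕ) (F : L2X X P) :
    rv (diffL2 hX P k F) =ᵐ[P] fun ω => rv F ω - rv (proj hX P {k}ᶜ F) ω := by
  rw [diffL2_apply]
  exact rv_sub _ _

/-- The integration by parts formula, for Lipschitz functions of `F`. -/
theorem hasSum_integral_mul_comp (hindep : iIndepFun X P) {F : L2X X P}
    (hF : F ∈ (gradMax hX P).domain) (G : (gradMax hX P).domain)
    (hG : ∀ H : (gradMax hX P).domain,
        inner ℝ F (H : L2X X P) = inner ℝ (gradMax hX P G) (gradMax hX P H))
    {f : ℝ → ℝ} {K : ℝ≥0} (hf : LipschitzWith K f) :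
    HasSum (fun k => ∫ ω, rv (diffL2 hX P k G) ω *
      (f (rv F ω) - f (rv (proj hX P {k}ᶜ F) ω)) ∂P) (∫ ω, rv F ω * f (rv F ω) ∂P) := by
  obtain ⟨Y, hY⟩ := exists_rv_comp_eq hf F
  choose Z hZ using fun k => exists_rv_comp_eq hf (proj hX P {k}ᶜ F)
  -- `Z k = f(𝔼[F | 𝒢_k])` is `𝒢_k`-measurable and so is annihilated by `D_k`. Subtracting it turns
  -- `f(F)` into an increment controlled by `K |D_k F|`, which also puts `f(F)` in the domain of
  -- `D`.
  have hDY : ∀ k, diffL2 hX P k Y = diffL2 hX P k (Y - Z k) := by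
    intro k
    rw [map_sub, diffL2_apply hX k (Z k), proj_comp_eq_self hX hf.continuous (hZ k), sub_self,
      sub_zero]
  have hYZ : ∀ k, rv (Y - Z k) =ᵐ[P] fun ω => f (rv F ω) - f (rv (proj hX P {k}ᶜ F) ω) := by
    intro k
    filter_upwards [rv_sub Y (Z k), hY, hZ k] with ω h1 h2 h3
    rw [h1, Pi.sub_apply, h2, h3]
  have hYd : Y ∈ (gradMax hX P).domain := by
    rw [mem_gradMax_domain]
    refine (((mem_gradMax_domain hX F).mp hF).norm.const_mul (K : ℝ)).mono' fun k => ?_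
    rw [hDY k]
    refine (norm_diffL2_le hX hindep k _).trans ?_
    rw [Real.norm_of_nonneg (by positivity)]
    refine Lp.norm_le_mul_norm_of_ae_le_mul ?_
    filter_upwards [hYZ k, rv_diffL2_ae hX k F] with ω h1 h2
    change ‖rv (Y - Z k) ω‖ ≤ K * ‖rv (diffL2 hX P k F) ω‖
    rw [h1, h2]
    exact hf.norm_sub_le _ _
  have h := lp.hasSum_inner (𝕜 := ℝ) (gradMax hX P G) (gradMax hX P ⟨Y, hYd⟩)
  rw [← hG ⟨Y, hYd⟩, inner_eq_integral] at h
  have h2 : ∫ ω, rv F ω * rv Y ω ∂P = ∫ ω, rv F ω * f (rv F ω) ∂P :=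
    integral_congr_ae (hY.mono fun ω h => by simp only [h])
  rw [h2] at h
  suffices hk : (fun k => ∫ ω, rv (diffL2 hX P k G) ω *
      (f (rv F ω) - f (rv (proj hX P {k}ᶜ F) ω)) ∂P) =
        fun k => inner ℝ (gradMax hX P G k) (gradMax hX P ⟨Y, hYd⟩ k) by
    rw [hk]
    exact h
  funext k
  -- The `D_k` acting on the increment moves to the other factor, where idempotence absorbs it into
  -- `D_k G`.
  rw [gradMax_apply, gradMax_apply, hDY k, ← inner_diffL2_left, diffL2_diffL2 hX hindep,
    inner_eq_integral]
  exact integral_congr_ae ((hYZ k).mono fun ω h => by simp only [h])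

end

/-! ### Series of integrable functions with summable `L¹` norms. -/

section Series

variable {Ω : Type*} [mΩ : MeasurableSpace Ω] {P : Measure Ω}

theorem tsum_lintegral_enorm_ne_top {u : ℕ → Ω → ℝ} (hu : ∀ k, Integrable (u k) P)
    (hs : Summable fun k => ∫ ω, ‖u k ω‖ ∂P) : ∑' k, ∫⁻ ω, ‖u k ω‖ₑ ∂P ≠ ∞ := by
  have h : ∀ k, ∫⁻ ω, ‖u k ω‖ₑ ∂P = ENNReal.ofReal (∫ ω, ‖u k ω‖ ∂P) := fun k =>
    (ofReal_integral_norm_eq_lintegral_enorm (hu k)).symm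
  simp_rw [h]
  exact hs.tsum_ofReal_ne_top

theorem ae_summable_of_summable_integral_norm {u : ℕ → Ω → ℝ} (hu : ∀ k, Integrable (u k) P)
    (hs : Summable fun k => ∫ ω, ‖u k ω‖ ∂P) : ∀ᵐ ω ∂P, Summable fun k => u k ω := by
  have := summable_norm_of_tsum_eLpNorm_ne_top le_rfl (fun k => (hu k).1)
    (by simpa only [eLpNorm_one_eq_lintegral_enorm] using tsum_lintegral_enorm_ne_top hu hs)
  exact this.mono fun ω h => h.of_norm

theorem integrable_tsum_of_summable_integral_norm {u : ℕ → Ω → ℝ}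
    (hu : ∀ k, Integrable (u k) P) (hs : Summable fun k => ∫ ω, ‖u k ω‖ ∂P) :
    Integrable (fun ω => ∑' k, u k ω) P := by
  refine ⟨aestronglyMeasurable_of_tendsto_ae atTop
    (f := fun n ω => ∑ k ∈ Finset.range n, u k ω) (fun n => ?_) ?_, ?_⟩
  · exact Finset.aestronglyMeasurable_fun_sum _ fun k _ => (hu k).1
  · exact (ae_summable_of_summable_integral_norm hu hs).mono
      fun ω h => h.hasSum.tendsto_sum_nat
  · refine lt_of_le_of_lt (lintegral_mono fun ω => enorm_tsum_le_tsum_enorm) ?_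
    rw [lintegral_tsum fun k => (hu k).1.enorm]
    exact (tsum_lintegral_enorm_ne_top hu hs).lt_top

theorem hasSum_integral_bdd_mul {u : ℕ → Ω → ℝ} (hu : ∀ k, Integrable (u k) P)
    (hs : Summable fun k => ∫ ω, ‖u k ω‖ ∂P) {b : Ω → ℝ} (hb : AEStronglyMeasurable b P) {C : ℝ}
    (hC : ∀ ω, ‖b ω‖ ≤ C) :
    HasSum (fun k => ∫ ω, b ω * u k ω ∂P) (∫ ω, b ω * ∑' k, u k ω ∂P) := by
  have hint : ∀ k, Integrable (fun ω => b ω * u k ω) P := fun k =>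
    (hu k).bdd_mul hb (ae_of_all _ hC)
  have h := hasSum_integral_of_summable_integral_norm hint ?_
  · simpa only [tsum_mul_left] using h
  · refine (hs.mul_left C).of_nonneg_of_le (fun k => integral_nonneg fun _ => norm_nonneg _)
      fun k => ?_
    rw [← integral_const_mul]
    refine integral_mono (hint k).norm ((hu k).norm.const_mul C) fun ω => ?_
    simp only [norm_mul]
    exact mul_le_mul_of_nonneg_right (hC ω) (norm_nonneg _)

theorem enorm_integral_bdd_mul_le {b u : Ω → ℝ} {C : ℝ} (hC : ∀ ω, |b ω| ≤ C) :
    ‖∫ ω, b ω * u ω ∂P‖ₑ ≤ ENNReal.ofReal C * ∫⁻ ω, ENNReal.ofReal |u ω| ∂P := by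
  refine (enorm_integral_le_lintegral_enorm _).trans ?_
  rw [← lintegral_const_mul' _ _ ENNReal.ofReal_ne_top]
  refine lintegral_mono fun ω => ?_
  rw [enorm_mul, Real.enorm_eq_ofReal_abs, Real.enorm_eq_ofReal_abs]
  gcongr
  exact hC _

end Series

/-! ### From Taylor remainders to Stein bounds. -/

section SteinBound

variable {Ω : Type*} [mΩ : MeasurableSpace Ω] {P : Measure Ω} [IsProbabilityMeasure P]
  {F : Ω → ℝ} {a d Fk : ℕ → Ω → ℝ} {f g : ℝ → ℝ}

/-- Comparison of `𝔼[g(F) - F f(F)]` with the Taylor remainders of `f` (with derivative `g`)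
in the integration by parts formula. -/
theorem enorm_integral_sub_le (hFf : Integrable (fun ω => F ω * f (F ω)) P)
    (hF : AEStronglyMeasurable F P)
    (had : ∀ k, Integrable (fun ω => a k ω * d k ω) P)
    (hs : Summable fun k => ∫ ω, ‖a k ω * d k ω‖ ∂P)
    (haf : ∀ k, Integrable (fun ω => a k ω * (f (F ω) - f (Fk k ω))) P)
    (hsum : HasSum (fun k => ∫ ω, a k ω * (f (F ω) - f (Fk k ω)) ∂P)
      (∫ ω, F ω * f (F ω) ∂P))
    (hg : Measurable g) {C : ℝ} (hC : ∀ x, |g x| ≤ C) :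
    HasSum (fun k => ∫ ω, a k ω * (f (F ω) - f (Fk k ω) - g (F ω) * d k ω) ∂P)
      (∫ ω, F ω * f (F ω) ∂P - ∫ ω, g (F ω) * ∑' k, a k ω * d k ω ∂P) ∧
    ‖∫ ω, (g (F ω) - F ω * f (F ω)) ∂P‖ₑ ≤
      ENNReal.ofReal C * ∫⁻ ω, ENNReal.ofReal |1 - ∑' k, a k ω * d k ω| ∂P +
      ‖∑' k, ∫ ω, a k ω * (f (F ω) - f (Fk k ω) - g (F ω) * d k ω) ∂P‖ₑ := by
  have hgF : AEStronglyMeasurable (fun ω => g (F ω)) P :=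
    (hg.comp_aemeasurable hF.aemeasurable).aestronglyMeasurable
  have hb := hasSum_integral_bdd_mul had hs hgF (fun ω => hC (F ω))
  have hS := integrable_tsum_of_summable_integral_norm had hs
  have hgS : Integrable (fun ω => g (F ω) * ∑' k, a k ω * d k ω) P :=
    hS.bdd_mul hgF (ae_of_all _ fun ω => hC (F ω))
  have hgi : Integrable (fun ω => g (F ω)) P :=
    (integrable_const C).mono' hgF (ae_of_all _ fun ω => hC (F ω))
  have hR : HasSum (fun k => ∫ ω, a k ω * (f (F ω) - f (Fk k ω) - g (F ω) * d k ω) ∂P)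
      (∫ ω, F ω * f (F ω) ∂P - ∫ ω, g (F ω) * ∑' k, a k ω * d k ω ∂P) := by
    suffices hk : (fun k => ∫ ω, a k ω * (f (F ω) - f (Fk k ω) - g (F ω) * d k ω) ∂P) =
        fun k => ∫ ω, a k ω * (f (F ω) - f (Fk k ω)) ∂P - ∫ ω, g (F ω) * (a k ω * d k ω) ∂P by
      rw [hk]
      exact hsum.sub hb
    funext k
    rw [← integral_sub (haf k) ((had k).bdd_mul hgF (ae_of_all _ fun ω => hC (F ω)))]
    refine integral_congr_ae (ae_of_all _ fun ω => ?_)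
    simp only
    ring
  refine ⟨hR, ?_⟩
  have hsplit : ∫ ω, (g (F ω) - F ω * f (F ω)) ∂P =
      ∫ ω, g (F ω) * (1 - ∑' k, a k ω * d k ω) ∂P -
        ∑' k, ∫ ω, a k ω * (f (F ω) - f (Fk k ω) - g (F ω) * d k ω) ∂P := by
    rw [hR.tsum_eq, integral_sub hgi hFf]
    simp only [mul_sub, mul_one]
    rw [integral_sub hgi hgS]
    ring
  rw [hsplit]
  exact enorm_sub_le.trans (add_le_add (enorm_integral_bdd_mul_le fun ω => hC _) le_rfl)

/-- The Stein bound for a test function with Lipschitz derivative. -/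
theorem enorm_integral_sub_le_of_sq (hFf : Integrable (fun ω => F ω * f (F ω)) P)
    (hF : AEStronglyMeasurable F P)
    (had : ∀ k, Integrable (fun ω => a k ω * d k ω) P)
    (hs : Summable fun k => ∫ ω, ‖a k ω * d k ω‖ ∂P)
    (haf : ∀ k, Integrable (fun ω => a k ω * (f (F ω) - f (Fk k ω))) P)
    (hsum : HasSum (fun k => ∫ ω, a k ω * (f (F ω) - f (Fk k ω)) ∂P)
      (∫ ω, F ω * f (F ω) ∂P))
    (hg : Measurable g) {C : ℝ} (hC : ∀ x, |g x| ≤ C)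
    (hd : ∀ k, d k =ᵐ[P] fun ω => F ω - Fk k ω)
    (hrem : ∀ x y, |f x - f y - g x * (x - y)| ≤ (x - y) ^ 2) :
    ‖∫ ω, (g (F ω) - F ω * f (F ω)) ∂P‖ₑ ≤
      ENNReal.ofReal C * ∫⁻ ω, ENNReal.ofReal |1 - ∑' k, a k ω * d k ω| ∂P +
      ∑' k, ∫⁻ ω, ENNReal.ofReal (|a k ω| * d k ω ^ 2) ∂P := by
  refine (enorm_integral_sub_le hFf hF had hs haf hsum hg hC).2.trans (add_le_add le_rfl ?_)
  refine enorm_tsum_le_tsum_enorm.trans (ENNReal.tsum_le_tsum fun k => ?_)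
  refine (enorm_integral_le_lintegral_enorm _).trans (lintegral_mono_ae ?_)
  filter_upwards [hd k] with ω h
  rw [Real.enorm_eq_ofReal_abs, abs_mul, h]
  exact ENNReal.ofReal_le_ofReal (mul_le_mul_of_nonneg_left (hrem _ _) (abs_nonneg _))

/-- The Stein bound for a test function whose Taylor remainder is controlled by the increments
of a function `ξ` bounded by `2` with oscillation at most `2`. -/
theorem enorm_integral_sub_le_of_monotone (hFf : Integrable (fun ω => F ω * f (F ω)) P)
    (hF : AEStronglyMeasurable F P)
    (had : ∀ k, Integrable (fun ω => a k ω * d k ω) P)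
    (hs : Summable fun k => ∫ ω, ‖a k ω * d k ω‖ ∂P)
    (haf : ∀ k, Integrable (fun ω => a k ω * (f (F ω) - f (Fk k ω))) P)
    (hsum : HasSum (fun k => ∫ ω, a k ω * (f (F ω) - f (Fk k ω)) ∂P)
      (∫ ω, F ω * f (F ω) ∂P))
    (hg : Measurable g) (hC : ∀ x, |g x| ≤ 1)
    (hd : ∀ k, d k =ᵐ[P] fun ω => F ω - Fk k ω)
    (hFk : ∀ k, AEStronglyMeasurable (Fk k) P)
    {ξ : ℝ → ℝ} (hξ : Measurable ξ) (hξ2 : ∀ x, |ξ x| ≤ 2) (hξosc : ∀ x y, |ξ x - ξ y| ≤ 2)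
    (hrem : ∀ x y, |f x - f y - g x * (x - y)| ≤ (x - y) * (ξ x - ξ y))
    {A B : ℕ → Ω → ℝ} (hAd : ∀ k, Integrable (fun ω => A k ω * d k ω) P)
    (hAs : Summable fun k => ∫ ω, ‖A k ω * d k ω‖ ∂P)
    (hBd : ∀ k, Integrable (fun ω => B k ω * d k ω) P)
    (hBs : Summable fun k => ∫ ω, ‖B k ω * d k ω‖ ∂P)
    (hAB : ∀ k, (fun ω => |a k ω|) =ᵐ[P] fun ω => A k ω + B k ω)
    (horth : ∀ k, ∫ ω, ξ (Fk k ω) * (A k ω * d k ω) ∂P = 0) :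
    ‖∫ ω, (g (F ω) - F ω * f (F ω)) ∂P‖ₑ ≤
      ∫⁻ ω, ENNReal.ofReal |1 - ∑' k, a k ω * d k ω| ∂P +
      2 * ∑' k, ∫⁻ ω, ENNReal.ofReal |B k ω * d k ω| ∂P +
      2 * ∫⁻ ω, ENNReal.ofReal |∑' k, A k ω * d k ω| ∂P := by
  have hmain := enorm_integral_sub_le hFf hF had hs haf hsum hg hC
  rw [ENNReal.ofReal_one, one_mul] at hmain
  have hξF : AEStronglyMeasurable (fun ω => ξ (F ω)) P :=
    (hξ.comp_aemeasurable hF.aemeasurable).aestronglyMeasurable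
  have hξFk : ∀ k, AEStronglyMeasurable (fun ω => ξ (Fk k ω)) P := fun k =>
    (hξ.comp_aemeasurable (hFk k).aemeasurable).aestronglyMeasurable
  have hξd : ∀ k, AEStronglyMeasurable (fun ω => ξ (F ω) - ξ (Fk k ω)) P :=
    fun k => hξF.sub (hξFk k)
  set r : ℕ → ℝ := fun k => ∫ ω, a k ω * (f (F ω) - f (Fk k ω) - g (F ω) * d k ω) ∂P with hr
  set s : ℕ → ℝ := fun k => ∫ ω, (ξ (F ω) - ξ (Fk k ω)) * (B k ω * d k ω) ∂P with hsdef
  have hA := hasSum_integral_bdd_mul hAd hAs hξF (fun ω => hξ2 (F ω))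
  have hBint : ∀ k, Integrable (fun ω => (ξ (F ω) - ξ (Fk k ω)) * (B k ω * d k ω)) P := fun k =>
    (hBd k).bdd_mul (hξd k) (ae_of_all _ fun ω => hξosc _ _)
  have hsle : ∀ k, ‖s k‖ ≤ 2 * ∫ ω, ‖B k ω * d k ω‖ ∂P := by
    intro k
    refine (norm_integral_le_integral_norm _).trans ?_
    rw [← integral_const_mul]
    refine integral_mono (hBint k).norm ((hBd k).norm.const_mul 2) fun ω => ?_
    simp only [norm_mul]
    exact mul_le_mul_of_nonneg_right (hξosc _ _) (by positivity)
  have hssum : Summable s := (hBs.mul_left 2).of_norm_bounded hsle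
  have hrle : ∀ k, ‖r k‖ ≤ ∫ ω, ξ (F ω) * (A k ω * d k ω) ∂P + s k := by
    intro k
    -- By `horth`, inserting `ξ (Fk k)` costs nothing. The recentred form is needed for the
    -- pointwise remainder bound; the uncentred one is needed to sum over `k` inside the integral.
    have h1 : ∫ ω, ξ (F ω) * (A k ω * d k ω) ∂P =
        ∫ ω, (ξ (F ω) - ξ (Fk k ω)) * (A k ω * d k ω) ∂P := by
      simp only [sub_mul]
      rw [integral_sub ((hAd k).bdd_mul hξF (ae_of_all _ fun ω => hξ2 _))
        ((hAd k).bdd_mul (hξFk k) (ae_of_all _ fun ω => hξ2 _)), horth k, sub_zero]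
    have hAint : Integrable (fun ω => (ξ (F ω) - ξ (Fk k ω)) * (A k ω * d k ω)) P :=
      (hAd k).bdd_mul (hξd k) (ae_of_all _ fun ω => hξosc _ _)
    rw [h1, hsdef, ← integral_add hAint (hBint k)]
    refine (norm_integral_le_integral_norm _).trans (integral_mono_ae ?_
      (hAint.add (hBint k)) ?_)
    · have h2 : Integrable (fun ω => a k ω * (f (F ω) - f (Fk k ω)) -
          g (F ω) * (a k ω * d k ω)) P :=
        (haf k).sub ((had k).bdd_mul (hg.comp_aemeasurable hF.aemeasurable).aestronglyMeasurable
          (ae_of_all _ fun ω => hC (F ω)))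
      refine (h2.congr (ae_of_all _ fun ω => ?_)).norm
      simp only
      ring
    · filter_upwards [hd k, hAB k] with ω h1 h2
      have h3 := mul_le_mul_of_nonneg_left (hrem (F ω) (Fk k ω)) (abs_nonneg (a k ω))
      simp only [norm_mul, Real.norm_eq_abs, h1]
      refine h3.trans (le_of_eq ?_)
      rw [h2]
      ring
  -- Summing before taking absolute values keeps the series `∑ A_k d_k` intact under the integral.
  have hfinal : ‖∑' k, r k‖ ≤ ∫ ω, ξ (F ω) * ∑' k, A k ω * d k ω ∂P + ∑' k, s k := by
    rw [← hA.tsum_eq, ← hA.summable.tsum_add hssum]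
    exact tsum_of_norm_bounded (hA.summable.add hssum).hasSum hrle
  refine hmain.2.trans ?_
  rw [add_assoc]
  refine add_le_add le_rfl ?_
  have hSA := integrable_tsum_of_summable_integral_norm hAd hAs
  calc ‖∑' k, r k‖ₑ ≤ ‖∫ ω, ξ (F ω) * ∑' k, A k ω * d k ω ∂P + ∑' k, s k‖ₑ := by
        rw [← ofReal_norm, ← ofReal_norm]
        exact ENNReal.ofReal_le_ofReal (hfinal.trans (le_abs_self _))
    _ ≤ ‖∑' k, s k‖ₑ + ‖∫ ω, ξ (F ω) * ∑' k, A k ω * d k ω ∂P‖ₑ := by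
        rw [add_comm]
        exact enorm_add_le _ _
    _ ≤ _ := by
        refine add_le_add ?_ ?_
        · rw [← ENNReal.tsum_mul_left, ← ENNReal.ofReal_ofNat 2]
          exact enorm_tsum_le_tsum_enorm.trans (ENNReal.tsum_le_tsum fun k =>
            enorm_integral_bdd_mul_le fun ω => hξosc _ _)
        · rw [← ENNReal.ofReal_ofNat 2]
          exact enorm_integral_bdd_mul_le fun ω => hξ2 _

end SteinBound

/-! ### The Gaussian density, distribution function and Mills ratio inequalities. -/

section Gaussian

/-- The standard normal density. -/
noncomputable abbrev stdPDF (x : ℝ) : ℝ := gaussianPDFReal 0 1 x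

/-- The standard normal distribution function. -/
noncomputable abbrev stdCDF (x : ℝ) : ℝ := (gaussianReal 0 1).real (Set.Iic x)

theorem stdPDF_eq (x : ℝ) : stdPDF x = (√(2 * Real.pi))⁻¹ * Real.exp (-x ^ 2 / 2) := by
  simp [stdPDF, gaussianPDFReal_def]

theorem stdPDF_pos (x : ℝ) : 0 < stdPDF x := gaussianPDFReal_pos 0 1 x one_ne_zero

theorem stdPDF_neg (x : ℝ) : stdPDF (-x) = stdPDF x := by simp [stdPDF_eq]

theorem hasDerivAt_stdPDF (x : ℝ) : HasDerivAt stdPDF (-x * stdPDF x) x := by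
  have h : HasDerivAt (fun x : ℝ => (√(2 * Real.pi))⁻¹ * Real.exp (-x ^ 2 / 2))
      ((√(2 * Real.pi))⁻¹ * (Real.exp (-x ^ 2 / 2) * (-(2 * x) / 2))) x := by
    have h1 : HasDerivAt (fun x : ℝ => -x ^ 2 / 2) (-(2 * x) / 2) x := by
      simpa using ((hasDerivAt_pow 2 x).neg.div_const 2)
    exact (h1.exp).const_mul _
  rw [funext stdPDF_eq]
  refine h.congr_deriv ?_
  ring

theorem continuous_stdPDF : Continuous stdPDF :=
  continuous_iff_continuousAt.mpr fun x => (hasDerivAt_stdPDF x).continuousAt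

theorem tendsto_stdPDF_atBot : Tendsto stdPDF atBot (𝓝 0) := by
  have h1 : Tendsto (fun x : ℝ => -x ^ 2 / 2) atBot atBot := by
    have h2 : Tendsto (fun x : ℝ => x ^ 2) atBot atTop :=
      ((tendsto_pow_atTop two_ne_zero).comp tendsto_neg_atBot_atTop).congr fun x => neg_sq x
    have h3 := (tendsto_neg_atTop_atBot.comp h2).atBot_div_const (r := (2 : ℝ)) two_pos
    exact h3
  have h := (Real.tendsto_exp_atBot.comp h1).const_mul (√(2 * Real.pi))⁻¹
  rw [mul_zero] at h
  exact h.congr fun x => (stdPDF_eq x).symm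

theorem stdCDF_eq_integral (x : ℝ) : stdCDF x = ∫ t in Set.Iic x, stdPDF t := by
  rw [stdCDF, measureReal_def, gaussianReal_apply_eq_integral 0 one_ne_zero,
    ENNReal.toReal_ofReal (integral_nonneg fun t => (stdPDF_pos t).le)]

theorem hasDerivAt_stdCDF (x : ℝ) : HasDerivAt stdCDF (stdPDF x) x := by
  have hint : Integrable stdPDF := integrable_gaussianPDFReal 0 1
  have h1 : ∀ y, stdCDF y = stdCDF 0 + ∫ t in (0 : ℝ)..y, stdPDF t := by
    intro y
    rw [stdCDF_eq_integral, stdCDF_eq_integral,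
      ← intervalIntegral.integral_Iic_sub_Iic hint.integrableOn hint.integrableOn]
    ring
  rw [funext h1]
  exact (intervalIntegral.integral_hasDerivAt_right (hint.intervalIntegrable)
    (continuous_stdPDF.stronglyMeasurableAtFilter _ _) continuous_stdPDF.continuousAt).const_add _

theorem stdCDF_nonneg (x : ℝ) : 0 ≤ stdCDF x := measureReal_nonneg

theorem stdCDF_le_one (x : ℝ) : stdCDF x ≤ 1 := measureReal_le_one

theorem stdCDF_mono : Monotone stdCDF := fun _ _ h => measureReal_mono (Set.Iic_subset_Iic.mpr h)

theorem tendsto_stdCDF_atBot : Tendsto stdCDF atBot (𝓝 0) :=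
  (tendsto_cdf_atBot (gaussianReal 0 1)).congr fun x => cdf_eq_real _ x

theorem tendsto_stdCDF_atTop : Tendsto stdCDF atTop (𝓝 1) :=
  (tendsto_cdf_atTop (gaussianReal 0 1)).congr fun x => cdf_eq_real _ x

theorem stdCDF_neg (x : ℝ) : stdCDF (-x) = 1 - stdCDF x := by
  have hderiv : ∀ y, HasDerivAt (fun y => stdCDF y + stdCDF (-y)) 0 y := by
    intro y
    have h1 := (hasDerivAt_stdCDF (-y)).comp y (hasDerivAt_neg y)
    refine ((hasDerivAt_stdCDF y).add h1).congr_deriv ?_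
    rw [stdPDF_neg]
    ring
  have hconst : ∀ y, stdCDF y + stdCDF (-y) = stdCDF x + stdCDF (-x) := fun y =>
    is_const_of_deriv_eq_zero (fun y => (hderiv y).differentiableAt) (fun y => (hderiv y).deriv) y x
  have hlim : Tendsto (fun y => stdCDF y + stdCDF (-y)) atTop (𝓝 (1 + 0)) :=
    tendsto_stdCDF_atTop.add (tendsto_stdCDF_atBot.comp tendsto_neg_atTop_atBot)
  have := tendsto_nhds_unique (tendsto_const_nhds.congr fun y => (hconst y).symm) hlim
  linarith

/-- First Mills ratio inequality. -/
theorem stdPDF_add_mul_stdCDF_nonneg (w : ℝ) : 0 ≤ stdPDF w + w * stdCDF w := by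
  rcases le_or_gt 0 w with hw | hw
  · exact add_nonneg (stdPDF_pos w).le (mul_nonneg hw (stdCDF_nonneg w))
  -- On the negative half-line `Φ + φ / x` decreases from its limit 0 at `-∞`, hence is nonpositive;
  -- multiplying by the negative `w` gives the claim.
  have hd : ∀ x ∈ Set.Iio (0 : ℝ), HasDerivAt (fun x => stdCDF x + stdPDF x / x)
      (-(stdPDF x / x ^ 2)) x := by
    intro x hx
    have hx0 : x ≠ 0 := (Set.mem_Iio.mp hx).ne
    refine ((hasDerivAt_stdCDF x).add ((hasDerivAt_stdPDF x).div (hasDerivAt_id x) hx0)).congr_deriv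
      ?_
    simp only [id]
    field_simp
    ring
  have hanti : AntitoneOn (fun x => stdCDF x + stdPDF x / x) (Set.Iio 0) := by
    refine antitoneOn_of_deriv_nonpos (convex_Iio 0)
      (fun x hx => (hd x hx).continuousAt.continuousWithinAt)
      (fun x hx => (hd x (interior_subset hx)).differentiableAt.differentiableWithinAt)
      fun x hx => ?_
    rw [(hd x (interior_subset hx)).deriv]
    have := stdPDF_pos x
    rw [neg_nonpos]
    positivity
  have hlim : Tendsto (fun x => stdCDF x + stdPDF x / x) atBot (𝓝 (0 + 0 * 0)) := by
    simp only [div_eq_mul_inv]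
    exact tendsto_stdCDF_atBot.add (tendsto_stdPDF_atBot.mul tendsto_inv_atBot_zero)
  have hle : stdCDF w + stdPDF w / w ≤ 0 + 0 * 0 := by
    refine ge_of_tendsto hlim ?_
    filter_upwards [eventually_le_atBot w] with x hx
    exact hanti (lt_of_le_of_lt hx hw) hw hx
  have h2 := mul_nonneg_of_nonpos_of_nonpos hw.le (hle.trans (by simp))
  rw [mul_add, mul_div_cancel₀ _ hw.ne] at h2
  linarith

/-- Second Mills ratio inequality. -/
theorem one_add_sq_mul_stdCDF_add_nonneg (w : ℝ) : 0 ≤ (1 + w ^ 2) * stdCDF w + w * stdPDF w := by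
  have hpos : ∀ x : ℝ, 0 < 1 + x ^ 2 := fun x => by positivity
  -- This combination increases from its limit 0 at `-∞`, hence is nonnegative.
  have hd : ∀ x, HasDerivAt (fun x => stdCDF x + x / (1 + x ^ 2) * stdPDF x)
      (2 * stdPDF x / (1 + x ^ 2) ^ 2) x := by
    intro x
    have h1 : HasDerivAt (fun x : ℝ => 1 + x ^ 2) (2 * x) x := by
      simpa using (hasDerivAt_pow 2 x).const_add 1
    have h2 := ((hasDerivAt_id x).div h1 (hpos x).ne').mul (hasDerivAt_stdPDF x)
    refine ((hasDerivAt_stdCDF x).add h2).congr_deriv ?_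
    have := (hpos x).ne'
    simp only [id, Pi.div_apply]
    field_simp
    ring
  have hmono : Monotone (fun x => stdCDF x + x / (1 + x ^ 2) * stdPDF x) := by
    refine monotone_of_deriv_nonneg (fun x => (hd x).differentiableAt) fun x => ?_
    rw [(hd x).deriv]
    have := stdPDF_pos x
    positivity
  have hlim : Tendsto (fun x => stdCDF x + x / (1 + x ^ 2) * stdPDF x) atBot (𝓝 (0 + 0)) := by
    refine tendsto_stdCDF_atBot.add (squeeze_zero_norm (fun x => ?_) tendsto_stdPDF_atBot)
    rw [norm_mul, norm_div, Real.norm_of_nonneg (hpos x).le, Real.norm_of_nonneg (stdPDF_pos x).le]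
    refine mul_le_of_le_one_left (stdPDF_pos x).le ((div_le_one (hpos x)).mpr ?_)
    rw [Real.norm_eq_abs]
    nlinarith [sq_abs x, sq_nonneg (|x| - 1), abs_nonneg x]
  have h := hmono.le_of_tendsto hlim w
  have h2 := mul_le_mul_of_nonneg_left h (hpos w).le
  rw [add_zero, mul_zero, mul_add, ← mul_assoc, mul_div_cancel₀ _ (hpos w).ne'] at h2
  exact h2

end Gaussian

/-! ### The Stein equation for indicators of half-lines. -/

section KolmogorovSolution

/-- The ratio `Φ / φ`. -/
noncomputable def millsLeft (w : ℝ) : ℝ := stdCDF w / stdPDF w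

/-- The ratio `(1 - Φ) / φ`. -/
noncomputable def millsRight (w : ℝ) : ℝ := (1 - stdCDF w) / stdPDF w

theorem millsLeft_neg (w : ℝ) : millsLeft (-w) = millsRight w := by
  rw [millsLeft, millsRight, stdCDF_neg, stdPDF_neg]

theorem hasDerivAt_millsLeft (w : ℝ) : HasDerivAt millsLeft (1 + w * millsLeft w) w := by
  refine ((hasDerivAt_stdCDF w).div (hasDerivAt_stdPDF w) (stdPDF_pos w).ne').congr_deriv ?_
  have := (stdPDF_pos w).ne'
  rw [millsLeft]
  field_simp
  ring

theorem hasDerivAt_millsRight (w : ℝ) : HasDerivAt millsRight (w * millsRight w - 1) w := by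
  have h := (hasDerivAt_millsLeft (-w)).comp w (hasDerivAt_neg w)
  rw [millsLeft_neg, show millsLeft ∘ Neg.neg = millsRight from funext millsLeft_neg] at h
  exact h.congr_deriv (by ring)

theorem one_add_mul_millsLeft_nonneg (w : ℝ) : 0 ≤ 1 + w * millsLeft w := by
  have h := div_nonneg (stdPDF_add_mul_stdCDF_nonneg w) (stdPDF_pos w).le
  rwa [add_div, div_self (stdPDF_pos w).ne', mul_div_assoc] at h

theorem mul_millsRight_le_one (w : ℝ) : w * millsRight w ≤ 1 := by
  have h := one_add_mul_millsLeft_nonneg (-w)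
  rw [millsLeft_neg] at h
  linarith

/-- The derivative is `((1 + w²) Φ + w φ) / φ`, nonnegative by the second Mills ratio inequality. -/
theorem monotone_mul_millsLeft : Monotone fun w => w * millsLeft w := by
  have hd : ∀ w, HasDerivAt (fun w => w * millsLeft w)
      (1 * millsLeft w + w * (1 + w * millsLeft w)) w := fun w =>
    (hasDerivAt_id w).mul (hasDerivAt_millsLeft w)
  refine monotone_of_deriv_nonneg (fun w => (hd w).differentiableAt) fun w => ?_
  rw [(hd w).deriv]
  have h := div_nonneg (one_add_sq_mul_stdCDF_add_nonneg w) (stdPDF_pos w).le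
  rw [add_div, mul_div_assoc, mul_div_cancel_right₀ _ (stdPDF_pos w).ne'] at h
  rw [millsLeft]
  linarith

theorem monotone_mul_millsRight : Monotone fun w => w * millsRight w := by
  intro x y hxy
  have h := monotone_mul_millsLeft (neg_le_neg hxy)
  simp only [millsLeft_neg] at h
  simp only
  linarith

/-- The bounded solution of the Stein equation for the indicator of `(-∞, z]`. -/
noncomputable def steinInd (z w : ℝ) : ℝ :=
  if w ≤ z then (1 - stdCDF z) * millsLeft w else stdCDF z * millsRight w

theorem steinInd_of_le {z w : ℝ} (h : w ≤ z) : steinInd z w = (1 - stdCDF z) * millsLeft w :=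
  if_pos h

theorem steinInd_of_ge {z w : ℝ} (h : z ≤ w) : steinInd z w = stdCDF z * millsRight w := by
  rcases h.eq_or_lt with rfl | h
  · rw [steinInd_of_le le_rfl, millsLeft, millsRight]
    ring
  · exact if_neg h.not_ge

theorem continuous_steinInd (z : ℝ) : Continuous (steinInd z) := by
  refine Continuous.if_le ?_ ?_ continuous_id continuous_const ?_
  · exact continuous_const.mul (continuous_iff_continuousAt.mpr
      fun w => (hasDerivAt_millsLeft w).continuousAt)
  · exact continuous_const.mul (continuous_iff_continuousAt.mpr
      fun w => (hasDerivAt_millsRight w).continuousAt)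
  · rintro w rfl
    exact (steinInd_of_le le_rfl).symm.trans (steinInd_of_ge le_rfl)

theorem monotone_mul_steinInd (z : ℝ) : Monotone fun w => w * steinInd z w := by
  have h0 : 0 ≤ 1 - stdCDF z := sub_nonneg.mpr (stdCDF_le_one z)
  have hl : ∀ x y, x ≤ y → y ≤ z → x * steinInd z x ≤ y * steinInd z y := by
    intro x y hxy hy
    rw [steinInd_of_le hy, steinInd_of_le (hxy.trans hy)]
    have := mul_le_mul_of_nonneg_left (monotone_mul_millsLeft hxy) h0
    simp only at this
    linarith
  have hr : ∀ x y, x ≤ y → z ≤ x → x * steinInd z x ≤ y * steinInd z y := by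
    intro x y hxy hx
    rw [steinInd_of_ge hx, steinInd_of_ge (hx.trans hxy)]
    have := mul_le_mul_of_nonneg_left (monotone_mul_millsRight hxy) (stdCDF_nonneg z)
    simp only at this
    linarith
  intro x y hxy
  rcases le_total y z with hy | hy
  · exact hl x y hxy hy
  rcases le_total z x with hx | hx
  · exact hr x y hxy hx
  · exact (hl x z hx le_rfl).trans (hr z y hy le_rfl)

/-- These sharp bounds yield `|g| ≤ 1` and oscillation at most 2 for `ξ`. One side of each case is a
Mills inequality. For the other, monotonicity of `Φ` replaces `z` by `w` in the prefactor, and the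
identity `Φ · (1 - Φ)/φ = (1 - Φ) · Φ/φ` reduces to the opposite Mills ratio. -/
theorem mul_steinInd_mem (z w : ℝ) : w * steinInd z w ∈ Set.Icc (stdCDF z - 1) (stdCDF z) := by
  have hz0 := stdCDF_nonneg z
  have hz1 := stdCDF_le_one z
  have hprod : stdCDF w * millsRight w = (1 - stdCDF w) * millsLeft w := by
    rw [millsLeft, millsRight]
    ring
  have hl := one_add_mul_millsLeft_nonneg w
  have hr := mul_millsRight_le_one w
  have hw0 := stdCDF_nonneg w
  have hw1 := stdCDF_le_one w
  have key : w * ((1 - stdCDF w) * millsLeft w) = stdCDF w * (w * millsRight w) := by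
    rw [← hprod]; ring
  rcases le_total w z with h | h
  · rw [steinInd_of_le h]
    have hm := stdCDF_mono h
    constructor
    · nlinarith
    · have h1 : (1 - stdCDF z) * (1 + w * millsLeft w) ≤ (1 - stdCDF w) * (1 + w * millsLeft w) :=
        mul_le_mul_of_nonneg_right (by linarith) hl
      have h2 : stdCDF w * (w * millsRight w) ≤ stdCDF w := mul_le_of_le_one_right hw0 hr
      linarith
  · rw [steinInd_of_ge h]
    have hm := stdCDF_mono h
    constructor
    · have h1 : stdCDF z * (1 - w * millsRight w) ≤ stdCDF w * (1 - w * millsRight w) :=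
        mul_le_mul_of_nonneg_right hm (by linarith)
      have h2 : 0 ≤ (1 - stdCDF w) * (1 + w * millsLeft w) := mul_nonneg (by linarith) hl
      linarith
    · nlinarith

/-- The right derivative of the solution of the Stein equation. -/
theorem hasDerivWithinAt_steinInd (z w : ℝ) :
    HasDerivWithinAt (steinInd z)
      (w * steinInd z w - (Set.Ici z).indicator 1 w + 1 - stdCDF z) (Set.Ici w) w := by
  rcases lt_or_ge w z with h | h
  · rw [Set.indicator_of_notMem (by simpa using h)]
    refine HasDerivAt.hasDerivWithinAt ?_
    have h1 := (hasDerivAt_millsLeft w).const_mul (1 - stdCDF z)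
    refine (h1.congr_of_eventuallyEq ?_).congr_deriv ?_
    · filter_upwards [eventually_lt_nhds h] with x hx using steinInd_of_le hx.le
    · rw [steinInd_of_le h.le]
      ring
  · rw [Set.indicator_of_mem (by simpa using h)]
    have h1 := ((hasDerivAt_millsRight w).const_mul (stdCDF z)).hasDerivWithinAt (s := Set.Ici w)
    refine (h1.congr (fun x hx => steinInd_of_ge (h.trans hx)) (steinInd_of_ge h)).congr_deriv ?_
    rw [steinInd_of_ge h, Pi.one_apply]
    ring

/-- Since `f' = w f + 1_{w ≤ z} - Φ(z)` away from `z`, and `w f` is monotone, two values of the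
derivative on a segment differ by at most the increment across it of `ξ = w f + 1_{w > z}`. The mean
value inequality turns this into the remainder bound, with no second derivative of `f`. -/
theorem exists_stein_solution_indicator (z : ℝ) : ∃ (f g ξ : ℝ → ℝ) (K : ℝ≥0),
    LipschitzWith K f ∧ Measurable g ∧ (∀ x, |g x| ≤ 1) ∧ Measurable ξ ∧ (∀ x, |ξ x| ≤ 2) ∧
      (∀ x y, |ξ x - ξ y| ≤ 2) ∧
      (∀ x y, |f x - f y - g x * (x - y)| ≤ (x - y) * (ξ x - ξ y)) ∧
      ∀ x, g x - x * f x =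
        (Set.Iic z).indicator 1 x - (gaussianReal 0 1).real (Set.Iic z) := by
  have hz0 := stdCDF_nonneg z
  have hz1 := stdCDF_le_one z
  set f := steinInd z with hf
  set k : ℝ → ℝ := fun w => w * f w with hk
  set g : ℝ → ℝ := fun w => k w + (Set.Iic z).indicator 1 w - stdCDF z with hg
  set ξ : ℝ → ℝ := fun w => k w + (Set.Ioi z).indicator 1 w with hξ
  have hkm : Monotone k := monotone_mul_steinInd z
  have hkb : ∀ w, stdCDF z - 1 ≤ k w ∧ k w ≤ stdCDF z := fun w => mul_steinInd_mem z w
  have hkc : Continuous k := continuous_id.mul (continuous_steinInd z)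
  have hind : ∀ w, (Set.Iic z).indicator (1 : ℝ → ℝ) w = 1 - (Set.Ioi z).indicator 1 w := by
    intro w
    by_cases h : w ≤ z
    · rw [Set.indicator_of_mem (by simpa using h), Set.indicator_of_notMem (by simpa using h)]
      simp
    · rw [Set.indicator_of_notMem (by simpa using h), Set.indicator_of_mem (by simpa using h)]
      simp
  have hg1 : ∀ x, |g x| ≤ 1 := by
    intro w
    rw [abs_le]
    rcases le_or_gt w z with h | h
    · have h1 : g w = k w + 1 - stdCDF z := by
        simp only [hg]
        rw [Set.indicator_of_mem (by simpa using h)]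
        simp
      have := hkb w
      rw [h1]
      constructor <;> linarith
    · have h1 : g w = k w - stdCDF z := by
        simp only [hg]
        rw [Set.indicator_of_notMem (by simpa using h)]
        simp
      have := hkb w
      rw [h1]
      constructor <;> linarith
  have hind01 : ∀ w, 0 ≤ (Set.Ioi z).indicator (1 : ℝ → ℝ) w ∧
      (Set.Ioi z).indicator (1 : ℝ → ℝ) w ≤ 1 := fun w =>
    ⟨Set.indicator_nonneg (fun _ _ => zero_le_one) w,
      Set.indicator_le_self' (fun _ _ => zero_le_one) w⟩
  have hosc : ∀ x y, |ξ x - ξ y| ≤ 2 := by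
    intro x y
    have h1 := hkb x
    have h2 := hkb y
    have h3 := hind01 x
    have h4 := hind01 y
    simp only [hξ]
    rw [abs_le]
    constructor <;> linarith
  have hmonoI : ∀ {x y : ℝ}, (y ∈ Set.Ioi z → x ∈ Set.Ioi z) →
      (Set.Ioi z).indicator (1 : ℝ → ℝ) y ≤ (Set.Ioi z).indicator 1 x := by
    intro x y h
    by_cases hy : y ∈ Set.Ioi z
    · rw [Set.indicator_of_mem hy, Set.indicator_of_mem (h hy)]
      simp
    · rw [Set.indicator_of_notMem hy]
      exact (hind01 x).1
  have hseg : ∀ a b x : ℝ, a < b → x ∈ Set.Icc a b →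
      |(f b - g x * b) - (f a - g x * a)| ≤ (ξ b - ξ a) * (b - a) := by
    intro a b x hab hx
    have h := norm_image_sub_le_of_norm_deriv_right_le_segment (a := a) (b := b)
      (f := fun t => f t - g x * t) (C := ξ b - ξ a)
      (f' := fun t => (t * steinInd z t - (Set.Ici z).indicator 1 t + 1 - stdCDF z) - g x * 1)
      (((continuous_steinInd z).sub (continuous_const.mul continuous_id)).continuousOn)
      (fun t _ => (hasDerivWithinAt_steinInd z t).sub
        ((hasDerivWithinAt_id t (Set.Ici t)).const_mul (g x))) ?_ b ⟨hab.le, le_rfl⟩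
    · exact h
    · intro t ht
      have hta := hkm ht.1
      have htb := hkm ht.2.le
      have hxa := hkm hx.1
      have hxb := hkm hx.2
      have hIa : (Set.Ioi z).indicator (1 : ℝ → ℝ) a ≤ (Set.Ioi z).indicator 1 x :=
        hmonoI fun h => lt_of_lt_of_le h hx.1
      have hIb : (Set.Ioi z).indicator (1 : ℝ → ℝ) x ≤ (Set.Ioi z).indicator 1 b :=
        hmonoI fun h => lt_of_lt_of_le h hx.2
      -- The right derivative jumps at `z` itself, hence `Set.Ici` against `Set.Ioi` in `ξ`. The
      -- mean value inequality only needs `t < b`, so `z ≤ t` forces `z < b` and the conventions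
      -- agree.
      have hJ : (Set.Ioi z).indicator (1 : ℝ → ℝ) a ≤ (Set.Ici z).indicator 1 t ∧
          (Set.Ici z).indicator (1 : ℝ → ℝ) t ≤ (Set.Ioi z).indicator 1 b := by
        by_cases h : t ∈ Set.Ici z
        · have hb : b ∈ Set.Ioi z := lt_of_le_of_lt h ht.2
          rw [Set.indicator_of_mem h, Set.indicator_of_mem hb]
          exact ⟨(hind01 a).2, le_rfl⟩
        · have ha : a ∉ Set.Ioi z := fun ha => h (ht.1.trans' (le_of_lt ha))
          rw [Set.indicator_of_notMem h, Set.indicator_of_notMem ha]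
          exact ⟨le_rfl, (hind01 b).1⟩
      simp only [hg, hξ, hind, Real.norm_eq_abs]
      change |(k t - _ + 1 - _) - _| ≤ _
      rw [abs_le]
      constructor <;> linarith [hJ.1, hJ.2]
  have hrem : ∀ x y, |f x - f y - g x * (x - y)| ≤ (x - y) * (ξ x - ξ y) := by
    intro x y
    rcases lt_trichotomy x y with h | rfl | h
    · have h1 := hseg x y x h ⟨le_rfl, h.le⟩
      rw [abs_sub_comm] at h1
      have e1 : f x - g x * x - (f y - g x * y) = f x - f y - g x * (x - y) := by ring
      rw [e1] at h1
      linarith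
    · simp
    · have h1 := hseg y x x h ⟨h.le, le_rfl⟩
      have e1 : f x - g x * x - (f y - g x * y) = f x - f y - g x * (x - y) := by ring
      rw [e1] at h1
      linarith
  -- The Lipschitz constant is 2 from the oscillation of `ξ` plus 1 from the bound on `g`.
  refine ⟨f, g, ξ, 3, ?_, ?_, hg1, ?_, ?_, hosc, hrem, ?_⟩
  · refine LipschitzWith.of_dist_le_mul fun x y => ?_
    rw [Real.dist_eq, Real.dist_eq]
    have h1 : |(x - y) * (ξ x - ξ y)| ≤ |x - y| * 2 := by
      rw [abs_mul]
      exact mul_le_mul_of_nonneg_left (hosc x y) (abs_nonneg _)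
    have h2 : |g x * (x - y)| ≤ 1 * |x - y| := by
      rw [abs_mul]
      exact mul_le_mul_of_nonneg_right (hg1 x) (abs_nonneg _)
    have h3 : f x - f y = (f x - f y - g x * (x - y)) + g x * (x - y) := by ring
    rw [h3]
    refine (abs_add_le _ _).trans ?_
    have h4 := (hrem x y).trans (le_abs_self _)
    push_cast
    linarith
  · exact (hkc.measurable.add (measurable_one.indicator measurableSet_Iic)).sub_const _
  · exact hkc.measurable.add (measurable_one.indicator measurableSet_Ioi)
  · intro x
    have h1 := hkb x
    have h2 := hind01 x
    simp only [hξ]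
    rw [abs_le]
    constructor <;> linarith
  · intro x
    simp only [hg, hk]
    ring

end KolmogorovSolution

/-! ### Gaussian integration by parts and the first absolute moment. -/

section GaussianIntegrals

theorem integrable_id_gaussian : Integrable (fun z : ℝ => z) (gaussianReal 0 1) :=
  (memLp_id_gaussianReal 1).integrable (by simp)

theorem integral_stdGaussian (f : ℝ → ℝ) :
    ∫ z, f z ∂(gaussianReal 0 1) = ∫ z, stdPDF z * f z := by
  rw [integral_gaussianReal_eq_integral_smul one_ne_zero]
  simp only [smul_eq_mul]

theorem integrable_stdGaussian_iff (f : ℝ → ℝ) :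
    Integrable f (gaussianReal 0 1) ↔ Integrable fun z => stdPDF z * f z := by
  rw [gaussianReal_of_var_ne_zero 0 one_ne_zero,
    integrable_withDensity_iff_integrable_smul' (measurable_gaussianPDF 0 1)
      (ae_of_all _ fun x => gaussianPDF_lt_top)]
  simp only [toReal_gaussianPDF, smul_eq_mul]

/-- Gaussian integration by parts. -/
theorem integral_id_mul_gaussian {v v' : ℝ → ℝ} (hv : ∀ x, HasDerivAt v (v' x) x)
    {C C' : ℝ} (hC : ∀ x, |v x| ≤ C) (hv'c : Continuous v') (hC' : ∀ x, |v' x| ≤ C') :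
    ∫ z, z * v z ∂(gaussianReal 0 1) = ∫ z, v' z ∂(gaussianReal 0 1) := by
  have hvc : Continuous v := continuous_iff_continuousAt.mpr fun x => (hv x).continuousAt
  have h1 : Integrable v (gaussianReal 0 1) :=
    (integrable_const C).mono' hvc.aestronglyMeasurable (ae_of_all _ hC)
  have h2 : Integrable v' (gaussianReal 0 1) :=
    (integrable_const C').mono' hv'c.aestronglyMeasurable (ae_of_all _ hC')
  have h3 : Integrable (fun z => z * v z) (gaussianReal 0 1) :=
    integrable_id_gaussian.mul_bdd hvc.aestronglyMeasurable (ae_of_all _ hC)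
  rw [integrable_stdGaussian_iff] at h1 h2 h3
  have h := integral_mul_deriv_eq_deriv_mul_of_integrable (u := stdPDF) (v := v)
    (u' := fun x => -x * stdPDF x) (v' := v') (fun x _ => hasDerivAt_stdPDF x) (fun x _ => hv x) h2
    (h3.neg.congr (ae_of_all _ fun x => by simp only [Pi.neg_apply, Pi.mul_apply]; ring)) h1
  rw [integral_stdGaussian, integral_stdGaussian, h, ← integral_neg]
  refine integral_congr_ae (ae_of_all _ fun x => ?_)
  simp only
  ring

theorem integral_abs_gaussian : ∫ z, |z| ∂(gaussianReal 0 1) = √(2 / Real.pi) := by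
  have h0 : ∫ z, stdPDF z * |z| = 2 * ∫ z in Set.Ioi (0 : ℝ), stdPDF z * z := by
    rw [← integral_comp_abs (f := fun z => stdPDF z * z)]
    refine integral_congr_ae (ae_of_all _ fun x => ?_)
    simp only [stdPDF_eq, sq_abs]
  have h1 : ∫ z in Set.Ioi (0 : ℝ), stdPDF z * z = 0 - -stdPDF 0 := by
    have hint : Integrable (fun z => stdPDF z * z) :=
      (integrable_stdGaussian_iff _).mp integrable_id_gaussian
    refine integral_Ioi_of_hasDerivAt_of_tendsto (f := fun z => -stdPDF z)
      (continuous_stdPDF.neg.continuousWithinAt) (fun x _ => ?_) hint.integrableOn ?_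
    · exact (hasDerivAt_stdPDF x).neg.congr_deriv (by ring)
    · have h := (tendsto_stdPDF_atBot.comp tendsto_neg_atTop_atBot).neg
      rw [neg_zero] at h
      exact h.congr fun x => by simp only [Function.comp_apply, stdPDF_neg]
  rw [integral_stdGaussian, h0, h1, stdPDF_eq]
  have hpi := Real.pi_pos
  rw [Real.sqrt_mul two_pos.le, Real.sqrt_div two_pos.le]
  have h2 : √(2 : ℝ) * √2 = 2 := Real.mul_self_sqrt two_pos.le
  have h3 : √(2 : ℝ) ≠ 0 := by positivity
  have h4 : √Real.pi ≠ 0 := by positivity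
  simp only [ne_eq, OfNat.ofNat_ne_zero, not_false_eq_true, zero_pow, neg_zero, zero_div,
    Real.exp_zero, zero_sub, neg_neg, mul_one]
  field_simp
  linarith

end GaussianIntegrals

/-! ### Bounding the second derivative of a Stein solution. -/

section MaximumPrinciple

/-- Here `g = f'` and `g' = f + w g + h'`. The weight `exp(-w²/2) / w²` is chosen so that
differentiating the weighted `f + w g` cancels every term in `g`, leaving `exp(-w²/2) (h'/w - 2
f/w³) ≥ 0`. The weighted function is thus nondecreasing and tends to 0 at infinity, so it is
nonpositive. -/
theorem add_mul_nonpos_of_pos {f g h' : ℝ → ℝ} {A B : ℝ} (hf : ∀ w, HasDerivAt f (g w) w)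
    (hg : ∀ w, HasDerivAt g (f w + w * g w + h' w) w) (hf0 : ∀ w, f w ≤ 0) (hh : ∀ w, 0 ≤ h' w)
    (hA : ∀ w, |f w| ≤ A) (hB : ∀ w, |g w| ≤ B) {w : ℝ} (hw : 0 < w) : f w + w * g w ≤ 0 := by
  set q : ℝ → ℝ := fun w => Real.exp (-w ^ 2 / 2) * ((f w + w * g w) / w ^ 2) with hq
  have hd : ∀ x ∈ Set.Ioi (0 : ℝ), HasDerivAt q
      (Real.exp (-x ^ 2 / 2) * ((-2 * f x + x ^ 2 * h' x) / x ^ 3)) x := by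
    intro x hx
    have hx0 : x ≠ 0 := (Set.mem_Ioi.mp hx).ne'
    have h1 : HasDerivAt (fun x : ℝ => -x ^ 2 / 2) (-(2 * x) / 2) x := by
      simpa using ((hasDerivAt_pow 2 x).neg.div_const 2)
    have h2 : HasDerivAt (fun w => f w + w * g w)
        (g x + (1 * g x + x * (f x + x * g x + h' x))) x :=
      (hf x).add ((hasDerivAt_id x).mul (hg x))
    have h3 : HasDerivAt (fun x : ℝ => x ^ 2) (2 * x) x := by simpa using hasDerivAt_pow 2 x
    refine (h1.exp.mul (h2.div h3 (pow_ne_zero 2 hx0))).congr_deriv ?_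
    simp only [Pi.div_apply]
    field_simp
    ring
  have hmono : MonotoneOn q (Set.Ioi 0) := by
    refine monotoneOn_of_deriv_nonneg (convex_Ioi 0)
      (fun x hx => (hd x hx).continuousAt.continuousWithinAt)
      (fun x hx => (hd x (interior_subset hx)).differentiableAt.differentiableWithinAt)
      fun x hx => ?_
    have hx' : 0 < x := interior_subset hx
    rw [(hd x hx').deriv]
    have h1 : 0 ≤ -2 * f x + x ^ 2 * h' x := by nlinarith [hf0 x, mul_nonneg (sq_nonneg x) (hh x)]
    positivity
  have hlim : Tendsto q atTop (𝓝 0) := by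
    have hb : Tendsto (fun x : ℝ => A * (x⁻¹ * x⁻¹) + B * x⁻¹) atTop (𝓝 0) := by
      have h1 := tendsto_inv_atTop_zero (𝕜 := ℝ)
      simpa using ((h1.mul h1).const_mul A).add (h1.const_mul B)
    refine squeeze_zero_norm' ?_ hb
    filter_upwards [eventually_gt_atTop 0] with x hx
    have he : Real.exp (-x ^ 2 / 2) ≤ 1 := Real.exp_le_one_iff.mpr (by nlinarith [sq_nonneg x])
    have hv : |f x + x * g x| ≤ A + x * B := by
      refine (abs_add_le _ _).trans (add_le_add (hA x) ?_)
      rw [abs_mul, abs_of_pos hx]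
      exact mul_le_mul_of_nonneg_left (hB x) hx.le
    rw [Real.norm_eq_abs, hq, abs_mul, abs_of_pos (Real.exp_pos _), abs_div,
      abs_of_pos (pow_pos hx 2)]
    have h1 : |f x + x * g x| / x ^ 2 ≤ (A + x * B) / x ^ 2 := by gcongr
    have h2 : (A + x * B) / x ^ 2 = A * (x⁻¹ * x⁻¹) + B * x⁻¹ := by field_simp
    rw [← h2]
    exact (mul_le_of_le_one_left (by positivity) he).trans h1
  have hle : q w ≤ 0 := by
    refine ge_of_tendsto hlim ?_
    filter_upwards [eventually_ge_atTop w] with x hx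
    exact hmono hw (hw.trans_le hx) hx
  by_contra hcon
  push Not at hcon
  have : 0 < q w := by
    simp only [hq]
    positivity
  linarith

/-- A maximum principle for the differentiated Stein equation. -/
theorem add_mul_nonpos {f g h' : ℝ → ℝ} {A B : ℝ} (hf : ∀ w, HasDerivAt f (g w) w)
    (hg : ∀ w, HasDerivAt g (f w + w * g w + h' w) w) (hf0 : ∀ w, f w ≤ 0) (hh : ∀ w, 0 ≤ h' w)
    (hA : ∀ w, |f w| ≤ A) (hB : ∀ w, |g w| ≤ B) (w : ℝ) : f w + w * g w ≤ 0 := by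
  rcases lt_trichotomy w 0 with hw | rfl | hw
  -- Reflection `w ↦ -w` preserves the differential equation, with `g` changing sign.
  · have h := add_mul_nonpos_of_pos (f := fun x => f (-x)) (g := fun x => -g (-x))
      (h' := fun x => h' (-x)) (A := A) (B := B)
      (fun x => ((hf (-x)).comp x (hasDerivAt_neg x)).congr_deriv (by ring))
      (fun x => ((hg (-x)).comp x (hasDerivAt_neg x)).neg.congr_deriv (by ring))
      (fun x => hf0 _) (fun x => hh _) (fun x => hA _)
      (fun x => by rw [abs_neg]; exact hB _) (neg_pos.mpr hw)
    simp only [neg_neg] at h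
    linarith
  · simpa using hf0 0
  · exact add_mul_nonpos_of_pos hf hg hf0 hh hA hB hw

/-- Both `f - 1` and `-f - 1` are nonpositive and solve the same equation with forcing `1 + h'` and
`1 - h'`, both nonnegative; the maximum principle applies to each. -/
theorem abs_add_mul_le_one {f g h' : ℝ → ℝ} {B : ℝ} (hf : ∀ w, HasDerivAt f (g w) w)
    (hg : ∀ w, HasDerivAt g (f w + w * g w + h' w) w) (hf1 : ∀ w, |f w| ≤ 1)
    (hh : ∀ w, |h' w| ≤ 1) (hB : ∀ w, |g w| ≤ B) (w : ℝ) : |f w + w * g w| ≤ 1 := by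
  have hf2 : ∀ w, |f w - 1| ≤ 2 := fun w => by
    have := abs_le.mp (hf1 w)
    rw [abs_le]; constructor <;> linarith
  have hf3 : ∀ w, |-f w - 1| ≤ 2 := fun w => by
    have := abs_le.mp (hf1 w)
    rw [abs_le]; constructor <;> linarith
  have h1 := add_mul_nonpos (f := fun x => f x - 1) (g := g) (h' := fun x => 1 + h' x)
    (fun x => (hf x).sub_const 1) (fun x => (hg x).congr_deriv (by ring))
    (fun x => by have := abs_le.mp (hf1 x); linarith)
    (fun x => by have := abs_le.mp (hh x); linarith) hf2 hB w
  have h2 := add_mul_nonpos (f := fun x => -f x - 1) (g := fun x => -g x)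
    (h' := fun x => 1 - h' x)
    (fun x => (hf x).neg.sub_const 1) (fun x => (hg x).neg.congr_deriv (by ring))
    (fun x => by have := abs_le.mp (hf1 x); linarith)
    (fun x => by have := abs_le.mp (hh x); linarith) hf3 (fun x => by rw [abs_neg]; exact hB x) w
  rw [abs_le]
  constructor <;> linarith

/-- Cauchy's mean value theorem compares the remainder with `(x - t)²`; it uses only pointwise
differentiability of `f` and the Lipschitz bound on `g`. -/
theorem abs_taylor_remainder_le {f g g' : ℝ → ℝ} (hf : ∀ w, HasDerivAt f (g w) w)
    (hg : ∀ w, HasDerivAt g (g' w) w) (hg' : ∀ w, |g' w| ≤ 2) (x y : ℝ) :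
    |f x - f y - g x * (x - y)| ≤ (x - y) ^ 2 := by
  have hlip : ∀ s t, |g s - g t| ≤ 2 * |s - t| := fun s t =>
    convex_univ.norm_image_sub_le_of_norm_hasDerivWithin_le
      (fun w _ => (hg w).hasDerivWithinAt) (fun w _ => hg' w) (Set.mem_univ t) (Set.mem_univ s)
  set R : ℝ → ℝ := fun t => f x - f t - g x * (x - t) with hR
  have hRd : ∀ t, HasDerivAt R (g x - g t) t := fun t =>
    (((hf t).const_sub (f x)).sub (((hasDerivAt_id t).const_sub x).const_mul (g x))).congr_deriv
      (by ring)
  have hSd : ∀ t, HasDerivAt (fun t => (x - t) ^ 2) (-(2 * (x - t))) t := fun t =>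
    (((hasDerivAt_id t).const_sub x).pow 2).congr_deriv (by simp)
  have key : ∀ c, c ≠ x → (x - y) ^ 2 * (g x - g c) = R y * -(2 * (x - c)) →
      |R y| ≤ (x - y) ^ 2 := by
    intro c hc h
    have hpos : 0 < 2 * |x - c| := by
      have := abs_pos.mpr (sub_ne_zero.mpr hc.symm)
      positivity
    have h1 := congrArg abs h
    rw [abs_mul, abs_mul, abs_neg, abs_mul, abs_two, abs_of_nonneg (sq_nonneg (x - y))] at h1
    refine le_of_mul_le_mul_right ?_ hpos
    rw [← h1]
    exact mul_le_mul_of_nonneg_left (hlip x c) (sq_nonneg _)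
  have hRx : R x = 0 := by simp [hR]
  have hRc : Continuous R := continuous_iff_continuousAt.mpr fun t => (hRd t).continuousAt
  have hSc : Continuous fun t : ℝ => (x - t) ^ 2 := by fun_prop
  rcases lt_trichotomy x y with h | rfl | h
  · obtain ⟨c, hc, h1⟩ := exists_ratio_hasDerivAt_eq_ratio_slope R (fun t => g x - g t) h
      hRc.continuousOn (fun t _ => hRd t) (fun t => (x - t) ^ 2) (fun t => -(2 * (x - t)))
      hSc.continuousOn (fun t _ => hSd t)
    rw [hRx] at h1
    exact key c hc.1.ne' (by linarith)
  · simp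
  · obtain ⟨c, hc, h1⟩ := exists_ratio_hasDerivAt_eq_ratio_slope R (fun t => g x - g t) h
      hRc.continuousOn (fun t _ => hRd t) (fun t => (x - t) ^ 2) (fun t => -(2 * (x - t)))
      hSc.continuousOn (fun t _ => hSd t)
    rw [hRx] at h1
    exact key c hc.2.ne (by linarith)

end MaximumPrinciple

/-! ### Smoothing Lipschitz functions by moving averages. -/

section Steklov

/-- The Steklov average of `h` over `[x, x + ε]`. -/
noncomputable def steklov (ε : ℝ) (h : ℝ → ℝ) (x : ℝ) : ℝ := ε⁻¹ * ∫ t in x..(x + ε), h t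

theorem hasDerivAt_steklov {h : ℝ → ℝ} (hh : Continuous h) (ε x : ℝ) :
    HasDerivAt (steklov ε h) (ε⁻¹ * (h (x + ε) - h x)) x := by
  have hi : ∀ a b, IntervalIntegrable h volume a b := fun a b => hh.intervalIntegrable a b
  have hH : ∀ y, HasDerivAt (fun y => ∫ t in (0 : ℝ)..y, h t) (h y) y := fun y =>
    intervalIntegral.integral_hasDerivAt_right (hi 0 y) (hh.stronglyMeasurableAtFilter _ _)
      hh.continuousAt
  have he : steklov ε h = fun x => ε⁻¹ * ((∫ t in (0 : ℝ)..(x + ε), h t) - ∫ t in (0 : ℝ)..x, h t) := by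
    funext y
    rw [steklov, intervalIntegral.integral_interval_sub_left (hi _ _) (hi _ _)]
  rw [he]
  have h1 : HasDerivAt (fun x => ∫ t in (0 : ℝ)..(x + ε), h t) (h (x + ε)) x :=
    (hH (x + ε)).comp_add_const x ε
  exact (h1.sub (hH x)).const_mul _

theorem abs_steklov_sub_le {h : ℝ → ℝ} (hh : LipschitzWith 1 h) {ε : ℝ} (hε : 0 < ε) (x : ℝ) :
    |steklov ε h x - h x| ≤ ε := by
  have hc := hh.continuous
  have h1 : steklov ε h x - h x = ε⁻¹ * ∫ t in x..(x + ε), (h t - h x) := by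
    rw [intervalIntegral.integral_sub (hc.intervalIntegrable _ _)
      (continuous_const.intervalIntegrable _ _), intervalIntegral.integral_const, steklov, mul_sub]
    simp only [add_sub_cancel_left, smul_eq_mul]
    field_simp
  have h2 : ‖∫ t in x..(x + ε), (h t - h x)‖ ≤ ε * |x + ε - x| := by
    refine intervalIntegral.norm_integral_le_of_norm_le_const fun t ht => ?_
    rw [Set.uIoc_of_le (by linarith)] at ht
    have h3 := hh.norm_sub_le t x
    rw [NNReal.coe_one, one_mul, Real.norm_eq_abs (t - x), abs_of_nonneg (by linarith [ht.1])] at h3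
    linarith [ht.2]
  rw [add_sub_cancel_left, abs_of_pos hε, Real.norm_eq_abs] at h2
  rw [h1, abs_mul, abs_of_pos (inv_pos.mpr hε), inv_mul_le_iff₀ hε]
  exact h2

theorem abs_slope_le {h : ℝ → ℝ} (hh : LipschitzWith 1 h) {ε : ℝ} (hε : 0 < ε) (x : ℝ) :
    |ε⁻¹ * (h (x + ε) - h x)| ≤ 1 := by
  have h3 := hh.norm_sub_le (x + ε) x
  rw [NNReal.coe_one, one_mul, add_sub_cancel_left, Real.norm_eq_abs, Real.norm_eq_abs,
    abs_of_pos hε] at h3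
  rw [abs_mul, abs_of_pos (inv_pos.mpr hε), inv_mul_le_iff₀ hε, mul_one]
  exact h3

theorem lipschitzWith_steklov {h : ℝ → ℝ} (hh : LipschitzWith 1 h) {ε : ℝ} (hε : 0 < ε) :
    LipschitzWith 1 (steklov ε h) := by
  refine lipschitzWith_of_nnnorm_deriv_le
    (fun x => (hasDerivAt_steklov hh.continuous ε x).differentiableAt) fun x => ?_
  rw [(hasDerivAt_steklov hh.continuous ε x).deriv, ← NNReal.coe_le_coe, coe_nnnorm]
  exact abs_slope_le hh hε x

/-- Uniform approximation of a `1`-Lipschitz function by `1`-Lipschitz functions with two bounded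
continuous derivatives. -/
theorem exists_smooth_approx {h₀ : ℝ → ℝ} (h : LipschitzWith 1 h₀) {ε : ℝ} (hε : 0 < ε) :
    ∃ (h₁ h₁' h₁'' : ℝ → ℝ) (C : ℝ), (∀ x, |h₀ x - h₁ x| ≤ ε) ∧
      (∀ x, HasDerivAt h₁ (h₁' x) x) ∧ (∀ x, HasDerivAt h₁' (h₁'' x) x) ∧ Continuous h₁'' ∧
      (∀ x, |h₁' x| ≤ 1) ∧ ∀ x, |h₁'' x| ≤ C := by
  -- Two averagings give two derivatives; each moves the function by at most `ε / 2`.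
  have hε2 : 0 < ε / 2 := half_pos hε
  set δ := ε / 2
  have h1 := lipschitzWith_steklov h hε2
  have hd : ∀ x, HasDerivAt (steklov δ h₀) (δ⁻¹ * (h₀ (x + δ) - h₀ x)) x :=
    hasDerivAt_steklov h.continuous δ
  refine ⟨steklov δ (steklov δ h₀), fun x => δ⁻¹ * (steklov δ h₀ (x + δ) - steklov δ h₀ x),
    fun x => δ⁻¹ * (δ⁻¹ * (h₀ (x + δ + δ) - h₀ (x + δ)) - δ⁻¹ * (h₀ (x + δ) - h₀ x)), δ⁻¹ * 2,
    fun x => ?_, hasDerivAt_steklov h1.continuous δ, fun x => ?_, ?_, abs_slope_le h1 hε2,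
    fun x => ?_⟩
  · have h2 := abs_le.mp (abs_steklov_sub_le h hε2 x)
    have h3 := abs_le.mp (abs_steklov_sub_le h1 hε2 x)
    have h4 : ε = δ + δ := (add_halves ε).symm
    rw [abs_le]
    constructor <;> linarith [h2.1, h2.2, h3.1, h3.2]
  · have h2 : HasDerivAt (fun x => steklov δ h₀ (x + δ))
        (δ⁻¹ * (h₀ (x + δ + δ) - h₀ (x + δ))) x :=
      (hd (x + δ)).comp_add_const x δ
    exact (h2.sub (hd x)).const_mul _
  · have := h.continuous
    fun_prop
  · rw [abs_mul, abs_of_pos (inv_pos.mpr hε2)]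
    refine mul_le_mul_of_nonneg_left ?_ (inv_pos.mpr hε2).le
    have h2 := abs_le.mp (abs_slope_le h hε2 (x + δ))
    have h3 := abs_le.mp (abs_slope_le h hε2 x)
    rw [abs_le]
    constructor <;> linarith [h2.1, h2.2, h3.1, h3.2]

end Steklov

/-! ### The Stein equation for Lipschitz functions, by Gaussian rotation. -/

section WassersteinSolution

/-- The Gaussian average `𝔼[u(cos θ w + sin θ Z)]`. -/
noncomputable def rotAvg (u : ℝ → ℝ) (w θ : ℝ) : ℝ :=
  ∫ z, u (Real.cos θ * w + Real.sin θ * z) ∂(gaussianReal 0 1)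

variable {u u' h h' h'' : ℝ → ℝ} {C C' : ℝ}

theorem abs_rotAvg_le (hC : ∀ x, |u x| ≤ C) (w θ : ℝ) : |rotAvg u w θ| ≤ C := by
  have := norm_integral_le_of_norm_le_const (μ := gaussianReal 0 1)
    (f := fun z => u (Real.cos θ * w + Real.sin θ * z)) (C := C) (ae_of_all _ fun z => hC _)
  simpa [rotAvg] using this

theorem continuous_rotAvg (hu : Continuous u) (hC : ∀ x, |u x| ≤ C) (w : ℝ) :
    Continuous fun θ => rotAvg u w θ := by
  refine continuous_of_dominated (bound := fun _ => C) (fun θ => ?_) (fun θ => ?_)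
    (integrable_const C) (ae_of_all _ fun z => by fun_prop)
  · exact (hu.comp (by fun_prop)).aestronglyMeasurable
  · exact ae_of_all _ fun z => hC _

theorem hasDerivAt_rotAvg_left (hu : ∀ x, HasDerivAt u (u' x) x) (hu'c : Continuous u')
    (hC : ∀ x, |u x| ≤ C) (hC' : ∀ x, |u' x| ≤ C') (w θ : ℝ) :
    HasDerivAt (fun w => rotAvg u w θ) (Real.cos θ * rotAvg u' w θ) w := by
  have huc : Continuous u := continuous_iff_continuousAt.mpr fun x => (hu x).continuousAt
  have hm : ∀ w, AEStronglyMeasurable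
      (fun z => u (Real.cos θ * w + Real.sin θ * z)) (gaussianReal 0 1) := fun w =>
    (huc.comp (by fun_prop)).aestronglyMeasurable
  have hd := (hasDerivAt_integral_of_dominated_loc_of_deriv_le (μ := gaussianReal 0 1)
    (F := fun w z => u (Real.cos θ * w + Real.sin θ * z))
    (F' := fun w z => Real.cos θ * u' (Real.cos θ * w + Real.sin θ * z))
    (x₀ := w) (s := Set.univ) (bound := fun _ => C') univ_mem (Eventually.of_forall hm)
    ((integrable_const C).mono' (hm w) (ae_of_all _ fun z => hC _))
    (continuous_const.mul (hu'c.comp (by fun_prop))).aestronglyMeasurable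
    (ae_of_all _ fun z x _ => ?_) (integrable_const C') (ae_of_all _ fun z x _ => ?_)).2
  · rw [integral_const_mul] at hd
    exact hd
  · rw [norm_mul]
    exact (mul_le_of_le_one_left (norm_nonneg _) (Real.abs_cos_le_one θ)).trans (hC' _)
  · have h1 : HasDerivAt (fun x => Real.cos θ * x + Real.sin θ * z) (Real.cos θ) x := by
      simpa using ((hasDerivAt_id x).const_mul (Real.cos θ)).add_const (Real.sin θ * z)
    exact ((hu _).comp x h1).congr_deriv (mul_comm _ _)

theorem integrable_comp_affine (hh : LipschitzWith 1 h) (a b : ℝ) :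
    Integrable (fun z => h (a + b * z)) (gaussianReal 0 1) := by
  refine (((integrable_id_gaussian.norm).const_mul |b|).add
    (integrable_const (|h 0| + |a|))).mono'
    (hh.continuous.comp (by fun_prop)).aestronglyMeasurable (ae_of_all _ fun z => ?_)
  have h1 := hh.norm_sub_le (a + b * z) 0
  have h2 := abs_sub_abs_le_abs_sub (h (a + b * z)) (h 0)
  have h3 := abs_add_le a (b * z)
  rw [abs_mul] at h3
  simp only [Real.norm_eq_abs, NNReal.coe_one, one_mul, sub_zero, Pi.add_apply] at h1 ⊢
  linarith

theorem integrable_mul_comp_affine (hu : Continuous u) (hC : ∀ x, |u x| ≤ C) (a b : ℝ) :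
    Integrable (fun z => z * u (a + b * z)) (gaussianReal 0 1) :=
  integrable_id_gaussian.mul_bdd (hu.comp (by fun_prop)).aestronglyMeasurable
    (ae_of_all _ fun z => hC _)

theorem integral_mul_comp_affine (hu : ∀ x, HasDerivAt u (u' x) x) (hu'c : Continuous u')
    (hC : ∀ x, |u x| ≤ C) (hC' : ∀ x, |u' x| ≤ C') (w θ : ℝ) :
    ∫ z, z * u (Real.cos θ * w + Real.sin θ * z) ∂(gaussianReal 0 1) =
      Real.sin θ * rotAvg u' w θ := by
  rw [rotAvg, ← integral_const_mul]
  refine integral_id_mul_gaussian (C := C) (C' := C')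
    (v := fun z => u (Real.cos θ * w + Real.sin θ * z))
    (v' := fun z => Real.sin θ * u' (Real.cos θ * w + Real.sin θ * z)) (fun x => ?_)
    (fun x => hC _) (continuous_const.mul (hu'c.comp (by fun_prop))) fun x => ?_
  · have h1 : HasDerivAt (fun z => Real.cos θ * w + Real.sin θ * z) (Real.sin θ) x := by
      simpa using ((hasDerivAt_id x).const_mul (Real.sin θ)).const_add (Real.cos θ * w)
    exact ((hu _).comp x h1).congr_deriv (mul_comm _ _)
  · rw [abs_mul]
    exact (mul_le_of_le_one_left (abs_nonneg _) (Real.abs_sin_le_one θ)).trans (hC' _)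

/-- Differentiating the rotation produces a factor `z`, which Gaussian integration by parts turns
into `h''`. As `θ` runs from 0 to `π/2`, the average goes from `h(w)` to `𝔼[h(Z)]`, so integrating
this derivative gives the Stein equation. -/
theorem hasDerivAt_rotAvg_right (hh : ∀ x, HasDerivAt h (h' x) x)
    (hh' : ∀ x, HasDerivAt h' (h'' x) x) (hc : Continuous h'') (h1 : ∀ x, |h' x| ≤ 1)
    (hC : ∀ x, |h'' x| ≤ C) (w θ : ℝ) :
    HasDerivAt (fun θ => rotAvg h w θ)
      (-w * (Real.sin θ * rotAvg h' w θ) + Real.sin θ * (Real.cos θ * rotAvg h'' w θ)) θ := by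
  have hlip : LipschitzWith 1 h := lipschitzWith_of_nnnorm_deriv_le
    (fun x => (hh x).differentiableAt) fun x => by
      rw [(hh x).deriv, ← NNReal.coe_le_coe, coe_nnnorm]
      exact h1 x
  have hc' : Continuous h' := continuous_iff_continuousAt.mpr fun x => (hh' x).continuousAt
  have hint' : Integrable (fun z => h' (Real.cos θ * w + Real.sin θ * z)) (gaussianReal 0 1) :=
    (integrable_const 1).mono' (hc'.comp (by fun_prop)).aestronglyMeasurable
      (ae_of_all _ fun z => h1 _)
  have hd := (hasDerivAt_integral_of_dominated_loc_of_deriv_le (μ := gaussianReal 0 1)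
    (F := fun θ z => h (Real.cos θ * w + Real.sin θ * z))
    (F' := fun θ z => h' (Real.cos θ * w + Real.sin θ * z) *
      (-Real.sin θ * w + Real.cos θ * z))
    (x₀ := θ) (s := Set.univ) (bound := fun z => |w| + |z|) univ_mem
    (Eventually.of_forall fun θ => (hlip.continuous.comp (by fun_prop)).aestronglyMeasurable)
    (integrable_comp_affine hlip _ _)
    ((hc'.comp (by fun_prop)).mul (by fun_prop)).aestronglyMeasurable
    (ae_of_all _ fun z x _ => ?_) ((integrable_const |w|).add integrable_id_gaussian.norm)
    (ae_of_all _ fun z x _ => ?_)).2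
  · refine hd.congr_deriv ?_
    have hsplit : ∀ z, h' (Real.cos θ * w + Real.sin θ * z) *
        (-Real.sin θ * w + Real.cos θ * z) =
        (-Real.sin θ * w) * h' (Real.cos θ * w + Real.sin θ * z) +
          Real.cos θ * (z * h' (Real.cos θ * w + Real.sin θ * z)) := fun z => by ring
    simp only [hsplit]
    rw [integral_add (hint'.const_mul _) ((integrable_mul_comp_affine hc' h1 _ _).const_mul _),
      integral_const_mul, integral_const_mul, integral_mul_comp_affine hh' hc h1 hC]
    simp only [rotAvg]
    ring
  · rw [norm_mul]
    refine (mul_le_of_le_one_left (norm_nonneg _) (h1 _)).trans ?_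
    refine (norm_add_le _ _).trans (add_le_add ?_ ?_)
    · rw [norm_mul, norm_neg]
      exact mul_le_of_le_one_left (norm_nonneg _) (Real.abs_sin_le_one x)
    · rw [norm_mul]
      exact mul_le_of_le_one_left (norm_nonneg _) (Real.abs_cos_le_one x)
  · have h2 : HasDerivAt (fun θ => Real.cos θ * w + Real.sin θ * z)
        (-Real.sin x * w + Real.cos x * z) x :=
      ((Real.hasDerivAt_cos x).mul_const w).add ((Real.hasDerivAt_sin x).mul_const z)
    exact (hh _).comp x h2

/-- The solution of the Stein equation for a smooth Lipschitz function with derivative `h'`. -/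
noncomputable def steinLip (h' : ℝ → ℝ) (w : ℝ) : ℝ :=
  -∫ θ in (0 : ℝ)..(Real.pi / 2), Real.sin θ * rotAvg h' w θ

/-- The derivative of `steinLip h'`, with `h''` the derivative of `h'`. -/
noncomputable def steinLipDeriv (h'' : ℝ → ℝ) (w : ℝ) : ℝ :=
  -∫ θ in (0 : ℝ)..(Real.pi / 2), Real.sin θ * (Real.cos θ * rotAvg h'' w θ)

theorem hasDerivAt_steinLip (hu : ∀ x, HasDerivAt u (u' x) x) (hu'c : Continuous u')
    (hC : ∀ x, |u x| ≤ C) (hC' : ∀ x, |u' x| ≤ C') (w : ℝ) :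
    HasDerivAt (steinLip u) (steinLipDeriv u' w) w := by
  have huc : Continuous u := continuous_iff_continuousAt.mpr fun x => (hu x).continuousAt
  have hcont : ∀ w, Continuous fun θ => Real.sin θ * rotAvg u w θ := fun w =>
    Real.continuous_sin.mul (continuous_rotAvg huc hC w)
  have hcont' : Continuous fun θ => Real.sin θ * (Real.cos θ * rotAvg u' w θ) :=
    Real.continuous_sin.mul (Real.continuous_cos.mul (continuous_rotAvg hu'c hC' w))
  refine HasDerivAt.neg ?_
  refine (intervalIntegral.hasDerivAt_integral_of_dominated_loc_of_deriv_le
    (F := fun w θ => Real.sin θ * rotAvg u w θ)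
    (F' := fun w θ => Real.sin θ * (Real.cos θ * rotAvg u' w θ))
    (s := Set.univ) (bound := fun _ => C') univ_mem
    (Eventually.of_forall fun w => (hcont w).aestronglyMeasurable)
    ((hcont w).intervalIntegrable _ _) hcont'.aestronglyMeasurable
    (ae_of_all _ fun θ _ x _ => ?_) (continuous_const.intervalIntegrable _ _)
    (ae_of_all _ fun θ _ x _ => ?_)).2
  · rw [norm_mul, norm_mul]
    refine (mul_le_of_le_one_left (by positivity) (Real.abs_sin_le_one θ)).trans ?_
    exact (mul_le_of_le_one_left (norm_nonneg _) (Real.abs_cos_le_one θ)).trans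
      (abs_rotAvg_le hC' x θ)
  · exact (hasDerivAt_rotAvg_left hu hu'c hC hC' x θ).const_mul _

theorem sin_nonneg_and_cos_nonneg {θ : ℝ} (hθ : θ ∈ Set.Ioc 0 (Real.pi / 2)) :
    0 ≤ Real.sin θ ∧ 0 ≤ Real.cos θ :=
  ⟨Real.sin_nonneg_of_nonneg_of_le_pi hθ.1.le (by linarith [hθ.2, Real.pi_pos]),
    Real.cos_nonneg_of_neg_pi_div_two_le_of_le (by linarith [hθ.1, Real.pi_pos]) hθ.2⟩

theorem abs_steinLip_le (h1 : ∀ x, |h' x| ≤ 1) (w : ℝ) : |steinLip h' w| ≤ 1 := by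
  rw [steinLip, abs_neg]
  have h := intervalIntegral.norm_integral_le_of_norm_le (μ := volume) (a := 0)
    (b := Real.pi / 2) (f := fun θ => Real.sin θ * rotAvg h' w θ) (g := Real.sin)
    (by positivity) (ae_of_all _ fun θ hθ => ?_) (Real.continuous_sin.intervalIntegrable _ _)
  · simpa using h
  · rw [norm_mul, Real.norm_of_nonneg (sin_nonneg_and_cos_nonneg hθ).1]
    exact mul_le_of_le_one_right (sin_nonneg_and_cos_nonneg hθ).1 (abs_rotAvg_le h1 w θ)

/-- Integration by parts in reverse replaces `sin θ 𝔼[h'']` by `𝔼[Z h']`, bounded by `𝔼|Z| = √(2/π)`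
whatever the size of `h''`; the remaining `cos θ` integrates to 1. -/
theorem abs_steinLipDeriv_le (hh' : ∀ x, HasDerivAt h' (h'' x) x) (hc : Continuous h'')
    (h1 : ∀ x, |h' x| ≤ 1) (hC : ∀ x, |h'' x| ≤ C) (w : ℝ) :
    |steinLipDeriv h'' w| ≤ √(2 / Real.pi) := by
  have hc' : Continuous h' := continuous_iff_continuousAt.mpr fun x => (hh' x).continuousAt
  rw [steinLipDeriv, abs_neg]
  have h := intervalIntegral.norm_integral_le_of_norm_le (μ := volume) (a := 0)
    (b := Real.pi / 2) (f := fun θ => Real.sin θ * (Real.cos θ * rotAvg h'' w θ))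
    (g := fun θ => Real.cos θ * √(2 / Real.pi))
    (by positivity) (ae_of_all _ fun θ hθ => ?_)
    ((Real.continuous_cos.mul continuous_const).intervalIntegrable _ _)
  · simpa using h
  · have h2 : Real.sin θ * (Real.cos θ * rotAvg h'' w θ) = Real.cos θ *
        ∫ z, z * h' (Real.cos θ * w + Real.sin θ * z) ∂(gaussianReal 0 1) := by
      rw [integral_mul_comp_affine hh' hc h1 hC]
      ring
    rw [h2, norm_mul, Real.norm_of_nonneg (sin_nonneg_and_cos_nonneg hθ).2,
      ← integral_abs_gaussian]
    refine mul_le_mul_of_nonneg_left ?_ (sin_nonneg_and_cos_nonneg hθ).2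
    refine (norm_integral_le_integral_norm _).trans (integral_mono
      (integrable_mul_comp_affine hc' h1 _ _).norm integrable_id_gaussian.norm fun z => ?_)
    simp only [norm_mul]
    exact mul_le_of_le_one_right (norm_nonneg _) (h1 _)

/-- The Stein equation. -/
theorem steinLip_equation (hh : ∀ x, HasDerivAt h (h' x) x)
    (hh' : ∀ x, HasDerivAt h' (h'' x) x) (hc : Continuous h'') (h1 : ∀ x, |h' x| ≤ 1)
    (hC : ∀ x, |h'' x| ≤ C) (w : ℝ) :
    steinLipDeriv h'' w - w * steinLip h' w = h w - ∫ y, h y ∂(gaussianReal 0 1) := by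
  have hc' : Continuous h' := continuous_iff_continuousAt.mpr fun x => (hh' x).continuousAt
  have hi1 : Continuous fun θ => -w * (Real.sin θ * rotAvg h' w θ) :=
    continuous_const.mul (Real.continuous_sin.mul (continuous_rotAvg hc' h1 w))
  have hi2 : Continuous fun θ => Real.sin θ * (Real.cos θ * rotAvg h'' w θ) :=
    Real.continuous_sin.mul (Real.continuous_cos.mul (continuous_rotAvg hc hC w))
  have h := intervalIntegral.integral_eq_sub_of_hasDerivAt (a := 0) (b := Real.pi / 2)
    (fun θ _ => hasDerivAt_rotAvg_right hh hh' hc h1 hC w θ)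
    ((hi1.add hi2).intervalIntegrable _ _)
  rw [intervalIntegral.integral_add (hi1.intervalIntegrable _ _) (hi2.intervalIntegrable _ _),
    intervalIntegral.integral_const_mul] at h
  simp only [rotAvg, Real.cos_pi_div_two, Real.sin_pi_div_two, Real.cos_zero, Real.sin_zero,
    zero_mul, one_mul, zero_add, add_zero, integral_const, probReal_univ, smul_eq_mul] at h
  simp only [steinLip, steinLipDeriv, rotAvg]
  linarith

/-- Smoothing is needed to solve the equation classically, but the bounds on the derivative and the
remainder do not depend on `ε`. -/
theorem exists_stein_solution_lipschitz {h₀ : ℝ → ℝ} (h : LipschitzWith 1 h₀) {ε : ℝ}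
    (hε : 0 < ε) : ∃ (h₁ f g : ℝ → ℝ) (K : ℝ≥0), Continuous h₁ ∧ (∀ x, |h₀ x - h₁ x| ≤ ε) ∧
      LipschitzWith K f ∧ Measurable g ∧ (∀ x, |g x| ≤ √(2 / Real.pi)) ∧
      (∀ x y, |f x - f y - g x * (x - y)| ≤ (x - y) ^ 2) ∧
      ∀ x, g x - x * f x = h₁ x - ∫ y, h₁ y ∂(gaussianReal 0 1) := by
  obtain ⟨h₁, h₁', h₁'', C, hclose, hd, hd', hc, h1, hC⟩ := exists_smooth_approx h hε
  have hf := hasDerivAt_steinLip hd' hc h1 hC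
  have hgb := abs_steinLipDeriv_le hd' hc h1 hC
  have hst := steinLip_equation hd hd' hc h1 hC
  have hg : ∀ w, HasDerivAt (steinLipDeriv h₁'')
      (steinLip h₁' w + w * steinLipDeriv h₁'' w + h₁' w) w := by
    intro w
    -- Reading the Stein equation as a formula for `f'` makes it differentiable without a third
    -- derivative of the test function.
    have he : steinLipDeriv h₁'' =
        fun w => w * steinLip h₁' w + (h₁ w - ∫ y, h₁ y ∂(gaussianReal 0 1)) := by
      funext x
      rw [← hst x]
      ring
    conv => enter [1]; rw [he]
    exact (((hasDerivAt_id w).mul (hf w)).add ((hd w).sub_const _)).congr_deriv (by simp)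
  have hg2 : ∀ w, |steinLip h₁' w + w * steinLipDeriv h₁'' w + h₁' w| ≤ 2 := by
    intro w
    have h2 := abs_add_mul_le_one hf hg (abs_steinLip_le h1) h1 hgb w
    refine (abs_add_le _ _).trans ?_
    linarith [h1 w]
  refine ⟨h₁, steinLip h₁', steinLipDeriv h₁'', (√(2 / Real.pi)).toNNReal,
    continuous_iff_continuousAt.mpr fun x => (hd x).continuousAt, hclose, ?_, ?_, hgb,
    abs_taylor_remainder_le hf hg hg2, hst⟩
  · refine lipschitzWith_of_nnnorm_deriv_le (fun x => (hf x).differentiableAt) fun x => ?_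
    rw [(hf x).deriv, ← NNReal.coe_le_coe, coe_nnnorm,
      Real.coe_toNNReal _ (Real.sqrt_nonneg _)]
    exact hgb x
  · exact (continuous_iff_continuousAt.mpr fun x => (hg x).continuousAt).measurable

end WassersteinSolution

/-! ### Square summability and orthogonality for the main theorem. -/

section

variable {Ω : Type*} [mΩ : MeasurableSpace Ω] {E : ℕ → Type*} [∀ n, MeasurableSpace (E n)]
  {X : ∀ n, Ω → E n} (hX : ∀ n, Measurable (X n)) {P : Measure Ω} [IsProbabilityMeasure P]

theorem integrable_rv_mul (U V : L2X X P) : Integrable (fun ω => rv U ω * rv V ω) P :=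
  (memLp_rv U).integrable_mul (memLp_rv V)

theorem norm_sq_eq_integral (U : L2X X P) : ‖U‖ ^ 2 = ∫ ω, rv U ω ^ 2 ∂P := by
  rw [← real_inner_self_eq_norm_sq, inner_eq_integral]
  simp only [sq]

theorem summable_integral_norm_rv_mul {U V : ℕ → L2X X P} (hU : Summable fun k => ‖U k‖ ^ 2)
    (hV : Summable fun k => ‖V k‖ ^ 2) :
    Summable fun k => ∫ ω, ‖rv (U k) ω * rv (V k) ω‖ ∂P := by
  refine (hU.add hV).of_nonneg_of_le (fun k => integral_nonneg fun _ => norm_nonneg _)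
    fun k => ?_
  rw [norm_sq_eq_integral, norm_sq_eq_integral,
    ← integral_add (memLp_rv _).integrable_sq (memLp_rv _).integrable_sq]
  refine integral_mono (integrable_rv_mul _ _).norm
    ((memLp_rv _).integrable_sq.add (memLp_rv _).integrable_sq) fun ω => ?_
  simp only [norm_mul, Real.norm_eq_abs]
  nlinarith [sq_nonneg (|rv (U k) ω| - |rv (V k) ω|), sq_abs (rv (U k) ω), sq_abs (rv (V k) ω),
    sq_nonneg (rv (U k) ω), sq_nonneg (rv (V k) ω)]

theorem summable_sq_of_mem_gradMax {F : L2X X P} (hF : F ∈ (gradMax hX P).domain) :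
    Summable fun k => ‖diffL2 hX P k F‖ ^ 2 := by
  have := ((mem_gradMax_domain hX F).mp hF).summable (by simp)
  simpa using this

/-- `D_k F` is orthogonal to every square-integrable `𝒢_k`-measurable variable; boundedness of `Y`
keeps the product square-integrable. -/
theorem integral_mul_rv_diffL2_eq_zero (k : ℕ) (F N : L2X X P)
    {Y : Ω → ℝ} (hY : AEStronglyMeasurable[sigmaOf X {k}ᶜ] Y P) {C : ℝ} (hC : ∀ ω, ‖Y ω‖ ≤ C) :
    ∫ ω, Y ω * (rv (proj hX P {k}ᶜ N) ω * rv (diffL2 hX P k F) ω) ∂P = 0 := by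
  have hN : AEStronglyMeasurable[sigmaOf X {k}ᶜ] (rv (proj hX P {k}ᶜ N)) P :=
    (stronglyMeasurable_condExp.aestronglyMeasurable).congr (rv_proj hX _ N).symm
  have hYN : AEStronglyMeasurable[sigmaOf X {k}ᶜ]
      (fun ω => Y ω * rv (proj hX P {k}ᶜ N) ω) P := hY.mul hN
  obtain ⟨V, hV⟩ := exists_rv_eq (X := X) (P := P)
    (Y := fun ω => Y ω * rv (proj hX P {k}ᶜ N) ω)
    ((memLp_rv (proj hX P {k}ᶜ N)).of_le_mul (c := C) (hYN.mono (sigmaOf_le hX _))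
      (ae_of_all _ fun ω => by
        rw [norm_mul]
        exact mul_le_mul_of_nonneg_right (hC ω) (norm_nonneg _)))
    (hYN.mono (sigmaOf_mono X (Set.subset_univ _)))
  have hVp : proj hX P {k}ᶜ V = V := (proj_eq_self_iff hX _ V).mpr (hYN.congr hV.symm)
  have h0 : inner ℝ V (diffL2 hX P k F) = 0 := by
    rw [← inner_diffL2_left, diffL2_apply, hVp, sub_self, inner_zero_left]
  rw [inner_eq_integral] at h0
  rw [← h0]
  refine integral_congr_ae (hV.mono fun ω h => ?_)
  simp only [h]
  ring

theorem aestronglyMeasurable_comp_proj {ξ : ℝ → ℝ} (hξ : Measurable ξ) (M : Set ℕ)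
    (F : L2X X P) :
    AEStronglyMeasurable[sigmaOf X M] (fun ω => ξ (rv (proj hX P M F) ω)) P :=
  ⟨fun ω => ξ ((P[rv F | sigmaOf X M]) ω),
    (hξ.comp stronglyMeasurable_condExp.measurable).stronglyMeasurable,
    (rv_proj hX M F).mono fun ω h => by simp only [h]⟩

theorem diffOp_congr_ae (k : ℕ) {Y Z : Ω → ℝ} (h : Y =ᵐ[P] Z) :
    diffOp X P k Y =ᵐ[P] diffOp X P k Z :=
  h.sub (condExp_congr_ae h)

end

/-! ### Bounding the two distances through test functions. -/

section Distances

variable {Ω : Type*} [mΩ : MeasurableSpace Ω] {P : Measure Ω} [IsProbabilityMeasure P]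

theorem dKol_map_le {Y : Ω → ℝ} (hY : AEMeasurable Y P) {ν : Measure ℝ} {R : ℝ≥0∞}
    (h : ∀ z, ‖∫ ω, ((Set.Iic z).indicator 1 (Y ω) - ν.real (Set.Iic z)) ∂P‖ₑ ≤ R) :
    dKol (P.map Y) ν ≤ R := by
  refine iSup_le fun z => ?_
  refine le_trans (le_of_eq ?_) (h z)
  rw [← Real.enorm_eq_ofReal_abs]
  congr 1
  have hint : Integrable (fun ω => (Set.Iic z).indicator (1 : ℝ → ℝ) (Y ω)) P := by
    refine (integrable_const (1 : ℝ)).mono'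
      ((measurable_one.indicator measurableSet_Iic).comp_aemeasurable hY).aestronglyMeasurable
      (ae_of_all _ fun ω => ?_)
    by_cases hω : Y ω ∈ Set.Iic z <;> simp [hω]
  rw [integral_sub hint (integrable_const _)]
  have h1 : ∫ ω, (Set.Iic z).indicator (1 : ℝ → ℝ) (Y ω) ∂P = (P.map Y).real (Set.Iic z) := by
    rw [← integral_map (f := (Set.Iic z).indicator (1 : ℝ → ℝ)) hY
      (measurable_one.indicator measurableSet_Iic).aestronglyMeasurable,
      integral_indicator_one measurableSet_Iic]
  rw [h1]
  simp

theorem dWass_map_le {Y : Ω → ℝ} (hY : Integrable Y P) {ν : Measure ℝ} [IsProbabilityMeasure ν]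
    (hν : Integrable id ν) {R : ℝ≥0∞}
    (h : ∀ h₀ : ℝ → ℝ, LipschitzWith 1 h₀ → ∀ ε > 0, ∃ h₁ : ℝ → ℝ, Continuous h₁ ∧
      (∀ x, |h₀ x - h₁ x| ≤ ε) ∧ ‖∫ ω, (h₁ (Y ω) - ∫ x, h₁ x ∂ν) ∂P‖ₑ ≤ R) :
    dWass (P.map Y) ν ≤ R := by
  refine iSup₂_le fun h₀ hh₀ => ?_
  refine ENNReal.le_of_forall_pos_le_add fun ε hε _ => ?_
  -- The approximation error is paid twice, once under each law.
  obtain ⟨h₁, hc, hclose, hbound⟩ := h h₀ hh₀ (ε / 2) (by positivity)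
  have : IsProbabilityMeasure (P.map Y) := Measure.isProbabilityMeasure_map hY.aemeasurable
  have hint : ∀ (μ : Measure ℝ) [IsProbabilityMeasure μ], Integrable id μ →
      Integrable h₀ μ ∧ Integrable h₁ μ := by
    intro μ _ hμ
    have h0 : Integrable h₀ μ := by
      refine ((hμ.norm).add (integrable_const |h₀ 0|)).mono'
        hh₀.continuous.aestronglyMeasurable (ae_of_all _ fun x => ?_)
      have h1 := hh₀.norm_sub_le x 0
      have h2 := abs_sub_abs_le_abs_sub (h₀ x) (h₀ 0)
      simp only [Real.norm_eq_abs, NNReal.coe_one, one_mul, sub_zero, id, Pi.add_apply] at h1 ⊢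
      linarith
    refine ⟨h0, ?_⟩
    have h1 : Integrable (fun x => h₀ x - h₁ x) μ :=
      (integrable_const ((ε : ℝ) / 2)).mono'
        (hh₀.continuous.sub hc).aestronglyMeasurable (ae_of_all _ hclose)
    exact (h0.sub h1).congr (ae_of_all _ fun x => by simp)
  have hYi : Integrable id (P.map Y) :=
    (integrable_map_measure aestronglyMeasurable_id hY.aemeasurable).mpr hY
  have hdiff : ∀ (μ : Measure ℝ) [IsProbabilityMeasure μ], Integrable id μ →
      |∫ x, h₀ x ∂μ - ∫ x, h₁ x ∂μ| ≤ ε / 2 := by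
    intro μ _ hμ
    rw [← integral_sub (hint μ hμ).1 (hint μ hμ).2]
    have := norm_integral_le_of_norm_le_const (μ := μ) (f := fun x => h₀ x - h₁ x)
      (ae_of_all _ hclose)
    simpa using this
  have h1 : ∫ ω, (h₁ (Y ω) - ∫ x, h₁ x ∂ν) ∂P = ∫ x, h₁ x ∂(P.map Y) - ∫ x, h₁ x ∂ν := by
    have hm := integral_map hY.aemeasurable (f := h₁) hc.aestronglyMeasurable
    have hi : Integrable (fun ω => h₁ (Y ω)) P :=
      (integrable_map_measure hc.aestronglyMeasurable hY.aemeasurable).mp (hint _ hYi).2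
    rw [integral_sub hi (integrable_const _), hm]
    simp
  rw [h1, Real.enorm_eq_ofReal_abs] at hbound
  calc ENNReal.ofReal |∫ x, h₀ x ∂(P.map Y) - ∫ x, h₀ x ∂ν|
      ≤ ENNReal.ofReal (|∫ x, h₁ x ∂(P.map Y) - ∫ x, h₁ x ∂ν| + ε) := by
        refine ENNReal.ofReal_le_ofReal ?_
        have h2 := abs_le.mp (hdiff (P.map Y) hYi)
        have h3 := abs_le.mp (hdiff ν hν)
        have h4 := abs_le.mp (le_refl |∫ x, h₁ x ∂(P.map Y) - ∫ x, h₁ x ∂ν|)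
        rw [abs_le]
        constructor <;> linarith [h2.1, h2.2, h3.1, h3.2, h4.1, h4.2]
    _ ≤ R + ε := by
        rw [ENNReal.ofReal_add (abs_nonneg _) ε.coe_nonneg, ENNReal.ofReal_coe_nnreal]
        exact add_le_add hbound le_rfl

end Distances

end ProdMalliavin

open ProdMalliavin

/-! ### Assembly of the Malliavin–Stein bounds. -/

theorem theorem3p4 {Ω : Type*} [MeasurableSpace Ω] (P : Measure Ω) [IsProbabilityMeasure P]
    {E : ℕ → Type*} [∀ n, MeasurableSpace (E n)] (X : ∀ n, Ω → E n)
    (hX : ∀ n, Measurable (X n)) (hindep : iIndepFun X P)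
    (F : L2X X P) (hFD : F ∈ (malD hX P).domain) (hF0 : ∫ ω, rv F ω ∂P = 0) :
    ∃ hFL : F ∈ (ouInv hX P).domain,
      let G : Ω → ℝ := rv (ouInv hX P ⟨F, hFL⟩)
      let D : ℕ → (Ω → ℝ) → Ω → ℝ := diffOp X P
      (∀ᵐ ω ∂P, Summable fun k => D k (-G) ω * D k (rv F) ω) ∧
      (∀ᵐ ω ∂P, Summable fun k =>
        (P[fun ω' => |D k G ω'| | sigmaOf X {k}ᶜ]) ω * D k (rv F) ω) ∧
      dWass (P.map (rv F)) (gaussianReal 0 1) ≤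
        ENNReal.ofReal √(2 / Real.pi) *
            ∫⁻ ω, ENNReal.ofReal |1 - ∑' k, D k (-G) ω * D k (rv F) ω| ∂P +
          ∑' k, ∫⁻ ω, ENNReal.ofReal (|D k (-G) ω| * D k (rv F) ω ^ 2) ∂P ∧
      dKol (P.map (rv F)) (gaussianReal 0 1) ≤
        ∫⁻ ω, ENNReal.ofReal |1 - ∑' k, D k (-G) ω * D k (rv F) ω| ∂P +
          2 * ∑' k, ∫⁻ ω, ENNReal.ofReal
            |D k (fun ω' => |D k G ω'|) ω * D k (rv F) ω| ∂P +
          2 * ∫⁻ ω, ENNReal.ofReal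
            |∑' k, (P[fun ω' => |D k G ω'| | sigmaOf X {k}ᶜ]) ω * D k (rv F) ω| ∂P := by
  obtain ⟨hFL, G, hinv, hG⟩ := exists_ouInv hX hindep (F := F) hF0
  have hFd : F ∈ (gradMax hX P).domain := by rwa [← malD_eq_gradMax hX hindep]
  refine ⟨hFL, ?_⟩
  intro G' D
  have habs : LipschitzWith 1 fun x : ℝ => |x| := LipschitzWith.of_dist_le_mul fun x y => by
    simpa [Real.dist_eq] using abs_abs_sub_abs_le_abs_sub x y
  -- `N k` represents `|D_k G|`. Here `G = -L⁻¹F`, and the sign is lost in the absolute value.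
  choose N hN using fun k => exists_rv_comp_eq habs (diffL2 hX P k G)
  set a : ℕ → Ω → ℝ := fun k => rv (diffL2 hX P k G) with ha
  set d : ℕ → Ω → ℝ := fun k => rv (diffL2 hX P k F) with hd
  set A : ℕ → Ω → ℝ := fun k => rv (proj hX P {k}ᶜ (N k)) with hA
  set B : ℕ → Ω → ℝ := fun k => rv (diffL2 hX P k (N k)) with hB
  have hG' : G' =ᵐ[P] -rv (G : L2X X P) := by
    change rv (ouInv hX P ⟨F, hFL⟩) =ᵐ[P] _
    rw [hinv]
    exact rv_neg _
  have hDG : ∀ k, D k (-G') =ᵐ[P] a k := fun k =>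
    (diffOp_congr_ae k (hG'.neg.trans (by rw [neg_neg]))).trans (rv_diffL2 hX P k G).symm
  have hDF : ∀ k, D k (rv F) =ᵐ[P] d k := fun k => (rv_diffL2 hX P k F).symm
  have hDabs : ∀ k, (fun ω => |D k G' ω|) =ᵐ[P] rv (N k) := by
    intro k
    have h1 : D k G' =ᵐ[P] rv (diffL2 hX P k (-(G : L2X X P))) :=
      (diffOp_congr_ae k (hG'.trans (rv_neg _).symm)).trans (rv_diffL2 hX P k _).symm
    rw [map_neg] at h1
    filter_upwards [h1, rv_neg (diffL2 hX P k (G : L2X X P)), hN k] with ω h1 h2 h3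
    rw [h1, h2, h3, Pi.neg_apply, abs_neg]
  have hAk : ∀ k, P[fun ω' => |D k G' ω'| | sigmaOf X {k}ᶜ] =ᵐ[P] A k := fun k =>
    (condExp_congr_ae (hDabs k)).trans (rv_proj hX _ (N k)).symm
  have hBk : ∀ k, D k (fun ω' => |D k G' ω'|) =ᵐ[P] B k := fun k =>
    (diffOp_congr_ae k (hDabs k)).trans (rv_diffL2 hX P k (N k)).symm
  have hasum : Summable fun k => ‖diffL2 hX P k (G : L2X X P)‖ ^ 2 :=
    summable_sq_of_mem_gradMax hX G.2
  have hdsum : Summable fun k => ‖diffL2 hX P k F‖ ^ 2 := summable_sq_of_mem_gradMax hX hFd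
  -- Taking absolute values preserves the norm, and projections contract it, so `A` and `B` inherit
  -- square summability from `D G`. Products with `D F` are then summable in `L¹`, which gives both
  -- almost sure convergences.
  have hNnorm : ∀ k, ‖N k‖ ^ 2 = ‖diffL2 hX P k (G : L2X X P)‖ ^ 2 := by
    intro k
    rw [norm_sq_eq_integral, norm_sq_eq_integral]
    exact integral_congr_ae ((hN k).mono fun ω h => by simp only [h, sq_abs])
  have hAsum : Summable fun k => ‖proj hX P {k}ᶜ (N k)‖ ^ 2 :=
    hasum.of_nonneg_of_le (fun k => sq_nonneg _) fun k => by
      rw [← hNnorm k]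
      gcongr
      exact norm_proj_le hX _ _
  have hBsum : Summable fun k => ‖diffL2 hX P k (N k)‖ ^ 2 :=
    hasum.of_nonneg_of_le (fun k => sq_nonneg _) fun k => by
      rw [← hNnorm k]
      gcongr
      exact norm_diffL2_le hX hindep _ _
  have had : ∀ k, Integrable (fun ω => a k ω * d k ω) P := fun k => integrable_rv_mul _ _
  have hads := summable_integral_norm_rv_mul hasum hdsum
  have hAd : ∀ k, Integrable (fun ω => A k ω * d k ω) P := fun k => integrable_rv_mul _ _
  have hAds := summable_integral_norm_rv_mul hAsum hdsum
  have hBd : ∀ k, Integrable (fun ω => B k ω * d k ω) P := fun k => integrable_rv_mul _ _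
  have hBds := summable_integral_norm_rv_mul hBsum hdsum
  have hprod : ∀ᵐ ω ∂P, ∀ k, D k (-G') ω * D k (rv F) ω = a k ω * d k ω :=
    ae_all_iff.mpr fun k => (hDG k).mul (hDF k)
  have hAprod : ∀ᵐ ω ∂P, ∀ k,
      (P[fun ω' => |D k G' ω'| | sigmaOf X {k}ᶜ]) ω * D k (rv F) ω = A k ω * d k ω :=
    ae_all_iff.mpr fun k => (hAk k).mul (hDF k)
  have hBprod : ∀ k, ∀ᵐ ω ∂P,
      D k (fun ω' => |D k G' ω'|) ω * D k (rv F) ω = B k ω * d k ω :=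
    fun k => (hBk k).mul (hDF k)
  have hFm : AEStronglyMeasurable (rv F) P := (memLp_rv F).1
  have hFf : ∀ {f : ℝ → ℝ} {K : ℝ≥0}, LipschitzWith K f →
      Integrable (fun ω => rv F ω * f (rv F ω)) P := fun hf =>
    (memLp_rv F).integrable_mul (memLp_comp_lipschitz hf (memLp_rv F))
  have haf : ∀ {f : ℝ → ℝ} {K : ℝ≥0}, LipschitzWith K f → ∀ k,
      Integrable (fun ω => a k ω * (f (rv F ω) - f (rv (proj hX P {k}ᶜ F) ω))) P := fun hf k =>
    (memLp_rv _).integrable_mul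
      ((memLp_comp_lipschitz hf (memLp_rv F)).sub (memLp_comp_lipschitz hf (memLp_rv _)))
  have hone : ∫⁻ ω, ENNReal.ofReal |1 - ∑' k, D k (-G') ω * D k (rv F) ω| ∂P =
      ∫⁻ ω, ENNReal.ofReal |1 - ∑' k, a k ω * d k ω| ∂P :=
    lintegral_congr_ae (hprod.mono fun ω h => by simp only [h])
  refine ⟨?_, ?_, ?_, ?_⟩
  · filter_upwards [ae_summable_of_summable_integral_norm had hads, hprod] with ω h1 h2
    simpa only [h2] using h1
  · filter_upwards [ae_summable_of_summable_integral_norm hAd hAds, hAprod] with ω h1 h2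
    simpa only [h2] using h1
  · refine dWass_map_le (integrable_rv F) ((memLp_id_gaussianReal 1).integrable (by simp))
      fun h₀ hh₀ ε hε => ?_
    obtain ⟨h₁, f, g, K, hc, hclose, hf, hg, hgC, hrem, hstein⟩ :=
      exists_stein_solution_lipschitz hh₀ hε
    refine ⟨h₁, hc, hclose, ?_⟩
    have h := enorm_integral_sub_le_of_sq (hFf hf) hFm had hads (haf hf)
      (hasSum_integral_mul_comp hX hindep hFd G hG hf) hg hgC (rv_diffL2_ae hX · F) hrem
    simp only [hstein] at h
    refine h.trans (le_of_eq ?_)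
    rw [hone]
    congr 2
    funext k
    refine lintegral_congr_ae ?_
    filter_upwards [hDG k, hDF k] with ω h1 h2
    rw [h1, h2]
  · refine dKol_map_le hFm.aemeasurable fun z => ?_
    obtain ⟨f, g, ξ, K, hf, hg, hgC, hξ, hξ2, hosc, hrem, hstein⟩ :=
      exists_stein_solution_indicator z
    have h := enorm_integral_sub_le_of_monotone (hFf hf) hFm had hads (haf hf)
      (hasSum_integral_mul_comp hX hindep hFd G hG hf) hg hgC (rv_diffL2_ae hX · F)
      (fun k => (memLp_rv (proj hX P {k}ᶜ F)).1) hξ hξ2 hosc hrem hAd hAds hBd hBds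
      (fun k => by
        filter_upwards [hN k, rv_diffL2_ae hX k (N k)] with ω h1 h2
        simp only [hA, hB, ha, h2, ← h1]
        ring)
      (fun k => integral_mul_rv_diffL2_eq_zero hX k F (N k)
        (aestronglyMeasurable_comp_proj hX hξ _ F) (fun ω => hξ2 _))
    simp only [hstein] at h
    refine h.trans (le_of_eq ?_)
    rw [hone]
    congr 1
    · congr 2
      refine tsum_congr fun k => lintegral_congr_ae ?_
      filter_upwards [hBprod k] with ω h1
      rw [h1]
    · congr 1
      exact lintegral_congr_ae (hAprod.mono fun ω h => by simp only [h])
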